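/- Let $\mathrm{Sol}$ be $\mathbb{R}^3$ with the Riemannian metric $e^{2z}dx^2+e^{-2z}dy^2+dz^2$. Let $\varphi:\Sigma^2\to\mathrm{Sol}$ be a smooth immersed surface, endowed with the induced metric and oriented by a smooth unit normal vector field $\xi$. Let $A$ be its shape operator, given by $\overline\nabla_X\xi=-d\varphi(AX)$ for $X$ tangent to $\Sigma^2$, where $\overline\nabla$ is the Levi-Civita connection of $\mathrm{Sol}$. Let $f=\tfrac12\operatorname{trace}A$ be its mean curvature function and $H=f\xi$ its mean curvature vector field. Let $\tau=\operatorname{trace}\nabla d\varphi$ be the tension field of $\varphi$ and $$S_2(X,Y)=\tfrac12|\tau|^2\langle X,Y\rangle+\langle d\varphi,\nabla\tau\rangle\langle X,Y\rangle-\langle d\varphi(X),\nabla_Y\tau\rangle-\langle d\varphi(Y),\nabla_X\tau\rangle$$ the stress-energy tensor of the bienergy. The surface is called biconservative if $\operatorname{Div}S_2=0$. **Proposition.** If $\Sigma^2$ is biconservative and has constant mean curvature (that is, $f$ is constant), then $\Sigma^2$ is minimal (that is, $H=0$). -/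

import Mathlib

open scoped ContDiff Manifold

noncomputable section

/-- The coordinate space `ℝⁿ`. Only its smooth structure and its coordinates are used below: the
lengths of tangent vectors are measured with explicitly given Riemannian metrics. -/
abbrev Coord (n : ℕ) : Type := EuclideanSpace ℝ (Fin n)

/-- The partial derivative `∂F/∂uᵢ`. -/
def partialD {m : ℕ} {V : Type*} [NormedAddCommGroup V] [NormedSpace ℝ V]
    (i : Fin m) (F : Coord m → V) (u : Coord m) : V :=
  fderiv ℝ F u (EuclideanSpace.single i 1)

/-- The Christoffel symbols `Γᵏᵢⱼ` of the Levi-Civita connection of the metric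
`∑ Gᵢⱼ dxᵢ dxⱼ` on (an open subset of) `ℝⁿ`. -/
def christoffel {n : ℕ} (G : Coord n → Matrix (Fin n) (Fin n) ℝ) (x : Coord n)
    (k i j : Fin n) : ℝ :=
  (1 / 2) * ∑ l, (G x)⁻¹ k l *
    (partialD i (fun y => G y j l) x + partialD j (fun y => G y i l) x
      - partialD l (fun y => G y i j) x)

/-- The inner product `⟨v, w⟩` of two tangent vectors at `x`, for the metric `G`. -/
def metricInner {n : ℕ} (G : Coord n → Matrix (Fin n) (Fin n) ℝ) (x v w : Coord n) : ℝ :=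
  ∑ a, ∑ b, G x a b * v a * w b

/-! ### Maps from (an open subset of) `ℝᵐ` into `ℝⁿ` with the metric `G` -/

/-- The metric induced on the domain by the map `X`. -/
def inducedMetric {m n : ℕ} (G : Coord n → Matrix (Fin n) (Fin n) ℝ) (X : Coord m → Coord n)
    (u : Coord m) : Matrix (Fin m) (Fin m) ℝ :=
  Matrix.of fun i j => metricInner G (X u) (partialD i X u) (partialD j X u)

/-- The covariant derivative in the direction `∂/∂uᵢ` of a vector field `V` along the map `X`,
for the connection pulled back from the Levi-Civita connection of `G`. -/
def covDeriv {m n : ℕ} (G : Coord n → Matrix (Fin n) (Fin n) ℝ) (X V : Coord m → Coord n)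
    (i : Fin m) (u : Coord m) : Coord n :=
  WithLp.toLp 2 fun a => partialD i V u a
    + ∑ b, ∑ c, christoffel G (X u) a b c * partialD i X u b * V u c

/-- The tension field `τ(X) = trace ∇dX`, the domain carrying the induced metric. -/
def tensionField {m n : ℕ} (G : Coord n → Matrix (Fin n) (Fin n) ℝ) (X : Coord m → Coord n)
    (u : Coord m) : Coord n :=
  ∑ i, ∑ j, (inducedMetric G X u)⁻¹ i j •
    (covDeriv G X (partialD j X) i u
      - ∑ k, christoffel (inducedMetric G X) u k i j • partialD k X u)

/-- The components `S₂(∂/∂uᵢ, ∂/∂uⱼ)` of the stress-energy tensor of the bienergy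
`S₂(Y, Z) = ½ |τ|² ⟨Y, Z⟩ + ⟨dX, ∇τ⟩ ⟨Y, Z⟩ - ⟨dX Y, ∇_Z τ⟩ - ⟨dX Z, ∇_Y τ⟩`. -/
def stressBienergy {m n : ℕ} (G : Coord n → Matrix (Fin n) (Fin n) ℝ) (X : Coord m → Coord n)
    (i j : Fin m) (u : Coord m) : ℝ :=
  (1 / 2) * metricInner G (X u) (tensionField G X u) (tensionField G X u)
      * inducedMetric G X u i j
    + (∑ k, ∑ l, (inducedMetric G X u)⁻¹ k l *
        metricInner G (X u) (partialD k X u) (covDeriv G X (tensionField G X) l u))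
      * inducedMetric G X u i j
    - metricInner G (X u) (partialD i X u) (covDeriv G X (tensionField G X) j u)
    - metricInner G (X u) (partialD j X u) (covDeriv G X (tensionField G X) i u)

/-- The component `(Div T)(∂/∂uₖ)` of the divergence of a 2-tensor `T` with respect to the
Levi-Civita connection of the metric `g`. -/
def divTensor {m : ℕ} (g : Coord m → Matrix (Fin m) (Fin m) ℝ)
    (T : Fin m → Fin m → Coord m → ℝ) (k : Fin m) (u : Coord m) : ℝ :=
  ∑ i, ∑ j, (g u)⁻¹ i j *
    (partialD i (T j k) u - (∑ l, christoffel g u l i j * T l k u)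
      - ∑ l, christoffel g u l i k * T j l u)

/-- The matrix of the shape operator `A` in the frame `∂/∂uᵢ`: the tangent vector
`A (∂/∂uᵢ) = ∑ₖ Aᵏᵢ ∂/∂uₖ` is given by the Weingarten equation `∇_{∂/∂uᵢ} ξ = - A (∂/∂uᵢ)`. -/
def shapeOperator {m n : ℕ} (G : Coord n → Matrix (Fin n) (Fin n) ℝ) (X ξ : Coord m → Coord n)
    (u : Coord m) : Matrix (Fin m) (Fin m) ℝ :=
  Matrix.of fun k i => - ∑ j, (inducedMetric G X u)⁻¹ k j *
    metricInner G (X u) (covDeriv G X ξ i u) (partialD j X u)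

/-- The mean curvature function `f = ½ trace A` of a parametrized surface with unit normal `ξ`. -/
def meanCurvature {n : ℕ} (G : Coord n → Matrix (Fin n) (Fin n) ℝ) (X ξ : Coord 2 → Coord n)
    (u : Coord 2) : ℝ :=
  (1 / 2) * (shapeOperator G X ξ u).trace

/-! ### Surfaces in Sol -/

/-- The metric `e^{2z} dx² + e^{-2z} dy² + dz²` of Sol. -/
def solMetric (p : Coord 3) : Matrix (Fin 3) (Fin 3) ℝ :=
  Matrix.diagonal ![Real.exp (2 * p 2), Real.exp (-2 * p 2), 1]

section Surface

variable {M : Type*} [TopologicalSpace M] [ChartedSpace (EuclideanSpace ℝ (Fin 2)) M]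

/-- `φ` is a smooth immersion of the surface `M` into Sol, oriented by the smooth unit normal
vector field `ξ`. -/
structure IsOrientedSurface (φ ξ : M → Coord 3) : Prop where
  smooth : ContMDiff (𝓡 2) (𝓡 3) ∞ φ
  immersion : ∀ p, Function.Injective (mfderiv (𝓡 2) (𝓡 3) φ p)
  normal_smooth : ContMDiff (𝓡 2) (𝓡 3) ∞ ξ
  normal_unit : ∀ p, metricInner solMetric (φ p) (ξ p) (ξ p) = 1
  normal_orthogonal : ∀ p, ∀ v : TangentSpace (𝓡 2) p,
    metricInner solMetric (φ p) (ξ p) (mfderiv (𝓡 2) (𝓡 3) φ p v) = 0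

/-- `Div S₂ = 0`, expressed in all the charts of the surface. -/
def IsBiconservative (φ : M → Coord 3) : Prop :=
  ∀ e ∈ atlas (EuclideanSpace ℝ (Fin 2)) M, ∀ u ∈ e.target, ∀ k,
    divTensor (inducedMetric solMetric (φ ∘ e.symm))
      (stressBienergy solMetric (φ ∘ e.symm)) k u = 0

/-- The mean curvature function (computed in any chart) is constant. -/
def IsCMC (φ ξ : M → Coord 3) : Prop :=
  ∃ c : ℝ, ∀ e ∈ atlas (EuclideanSpace ℝ (Fin 2)) M, ∀ u ∈ e.target,
    meanCurvature solMetric (φ ∘ e.symm) (ξ ∘ e.symm) u = c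

/-- The mean curvature vector field `H = f ξ` (computed in any chart) vanishes. -/
def IsMinimal (φ ξ : M → Coord 3) : Prop :=
  ∀ e ∈ atlas (EuclideanSpace ℝ (Fin 2)) M, ∀ u ∈ e.target,
    meanCurvature solMetric (φ ∘ e.symm) (ξ ∘ e.symm) u • ξ (e.symm u) = 0

end Surface

end

open scoped ContDiff Manifold

noncomputable section

/-! ### Partial derivatives -/

/-! The statement is local, so it suffices to work in a chart, where everything reduces to
`IsLocalSurface.eq_zero_of_biconservative`: a parametrized biconservative surface of constant mean
curvature c has c = 0. Suppose c ≠ 0.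

Since f = c, the tension field is 2cξ, and the stress-energy tensor becomes -2c²g + 4ch, with h the
second fundamental form (`stressBienergy_eq`). The metric is parallel, so biconservativity says Div
h = 0 (`divTensor_stressBienergy`). Also d(trace h) = 0. In dimension two these two trace conditions
force ∇h to be totally symmetric, so by the Codazzi equation the normal part of the ambient
curvature R(∂₀,∂₁)∂ₖ vanishes. Equivalently, ξ is an eigenvector of the Ricci tensor of Sol, which
is diag(0, 0, -2) in the frame E₁ = e^{-z}∂x, E₂ = e^{z}∂y, E₃ = ∂z. Hence at each point ξ is either
vertical or horizontal (`normal_vertical_or_horizontal`), and by continuity one alternative persists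
near a given point.

If ξ is vertical, the surface lies in a level set of z, and these are minimal. If ξ = cos θ E₁ + sin
θ E₂, let ω be the form dual to -sin θ E₁ + cos θ E₂. Then g = ω² + dz² and h = -(dθ ⊗ ω + sin 2θ ω
⊗ dz). Symmetry of h and trace h = 2c give dθ = sin 2θ dz - 2c ω (`partialD_angle`), while dω = cos
2θ ω ∧ dz (`partialD_horizontalForm_sub`). Now d(dθ) = 0 reads -6c cos 2θ ω ∧ dz = 0, so cos 2θ = 0
and dθ = 0. Then sin 2θ dz = 2c ω, which contradicts the independence of ω and dz. To avoid choosing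
an angle, the code carries p = cos θ and q = sin θ and writes dθ as p dq - q dp. -/

theorem partialD_congr {m : ℕ} {V : Type*} [NormedAddCommGroup V] [NormedSpace ℝ V] {i : Fin m}
    {F F' : Coord m → V} {u : Coord m} (h : F =ᶠ[nhds u] F') :
    partialD i F u = partialD i F' u := by
  unfold partialD; rw [h.fderiv_eq]

theorem partialD_const {m : ℕ} {V : Type*} [NormedAddCommGroup V] [NormedSpace ℝ V] (i : Fin m)
    (c : V) (u : Coord m) : partialD i (fun _ => c) u = 0 := by
  simp [partialD]

theorem partialD_add {m : ℕ} {V : Type*} [NormedAddCommGroup V] [NormedSpace ℝ V] {i : Fin m}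
    {F F' : Coord m → V} {u : Coord m} (h : DifferentiableAt ℝ F u)
    (h' : DifferentiableAt ℝ F' u) :
    partialD i (fun y => F y + F' y) u = partialD i F u + partialD i F' u := by
  unfold partialD; rw [fderiv_fun_add h h']; rfl

theorem partialD_sub {m : ℕ} {V : Type*} [NormedAddCommGroup V] [NormedSpace ℝ V] {i : Fin m}
    {F F' : Coord m → V} {u : Coord m} (h : DifferentiableAt ℝ F u)
    (h' : DifferentiableAt ℝ F' u) :
    partialD i (fun y => F y - F' y) u = partialD i F u - partialD i F' u := by
  unfold partialD; rw [fderiv_fun_sub h h']; rfl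

theorem partialD_neg {m : ℕ} {V : Type*} [NormedAddCommGroup V] [NormedSpace ℝ V] {i : Fin m}
    {F : Coord m → V} {u : Coord m} :
    partialD i (fun y => - F y) u = - partialD i F u := by
  unfold partialD; rw [fderiv_fun_neg]; rfl

theorem partialD_mul {m : ℕ} {i : Fin m} {F F' : Coord m → ℝ} {u : Coord m}
    (h : DifferentiableAt ℝ F u) (h' : DifferentiableAt ℝ F' u) :
    partialD i (fun y => F y * F' y) u = partialD i F u * F' u + F u * partialD i F' u := by
  unfold partialD; rw [fderiv_fun_mul h h']; simp; ring

theorem partialD_const_mul {m : ℕ} {i : Fin m} {F : Coord m → ℝ} {u : Coord m} (c : ℝ)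
    (h : DifferentiableAt ℝ F u) :
    partialD i (fun y => c * F y) u = c * partialD i F u := by
  unfold partialD; rw [fderiv_const_mul h]; simp

theorem partialD_exp {m : ℕ} {i : Fin m} {F : Coord m → ℝ} {u : Coord m}
    (h : DifferentiableAt ℝ F u) :
    partialD i (fun y => Real.exp (F y)) u = Real.exp (F u) * partialD i F u := by
  unfold partialD; rw [fderiv_exp h]; simp

theorem differentiableAt_coord {m n : ℕ} {F : Coord m → Coord n} {u : Coord m}
    (h : DifferentiableAt ℝ F u) (a : Fin n) : DifferentiableAt ℝ (fun y => F y a) u :=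
  (differentiableAt_euclidean (𝕜 := ℝ)).1 h a

theorem contDiffAt_coord {m n : ℕ} {F : Coord m → Coord n} {u : Coord m}
    (h : ContDiffAt ℝ ∞ F u) (a : Fin n) : ContDiffAt ℝ ∞ (fun y => F y a) u :=
  (contDiffAt_euclidean (𝕜 := ℝ)).1 h a

theorem partialD_coord {m n : ℕ} {i : Fin m} {F : Coord m → Coord n} {u : Coord m}
    (h : DifferentiableAt ℝ F u) (a : Fin n) :
    partialD i (fun y => F y a) u = partialD i F u a := by
  unfold partialD
  have := ((EuclideanSpace.proj (𝕜 := ℝ) a).hasFDerivAt.comp u h.hasFDerivAt).fderiv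
  have e : (fun y => F y a) = (EuclideanSpace.proj (𝕜 := ℝ) a) ∘ F := rfl
  rw [e, this]; rfl

theorem ContDiffAt.partialD {m : ℕ} {V : Type*} [NormedAddCommGroup V] [NormedSpace ℝ V]
    {F : Coord m → V} {u : Coord m} (h : ContDiffAt ℝ ∞ F u) (i : Fin m) :
    ContDiffAt ℝ ∞ (partialD i F) u :=
  (h.fderiv_right (m := ∞) (by simp)).clm_apply contDiffAt_const

theorem ContDiffAt.differentiableAt_of_infty {m : ℕ} {V : Type*} [NormedAddCommGroup V]
    [NormedSpace ℝ V] {F : Coord m → V} {u : Coord m} (h : ContDiffAt ℝ ∞ F u) :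
    DifferentiableAt ℝ F u := h.differentiableAt (by simp)

theorem partialD_comm {m : ℕ} {V : Type*} [NormedAddCommGroup V] [NormedSpace ℝ V]
    {F : Coord m → V} {u : Coord m} (h : ContDiffAt ℝ ∞ F u) (i j : Fin m) :
    partialD i (partialD j F) u = partialD j (partialD i F) u := by
  have hd : DifferentiableAt ℝ (fderiv ℝ F) u :=
    (h.fderiv_right (m := ∞) (by simp)).differentiableAt (by simp)
  have key : ∀ a b : Fin m, partialD a (partialD b F) u
      = fderiv ℝ (fderiv ℝ F) u (EuclideanSpace.single a 1) (EuclideanSpace.single b 1) := by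
    intro a b
    change fderiv ℝ (fun y => fderiv ℝ F y (EuclideanSpace.single b 1)) u _ = _
    rw [fderiv_clm_apply hd (differentiableAt_const _)]
    simp
  rw [key, key]
  exact (h.isSymmSndFDerivAt (by simpa using WithTop.coe_le_coe.2 (le_top : (2 : ℕ∞) ≤ ⊤))) _ _

/-! ### The Levi-Civita connection of Sol -/

theorem metricInner_solMetric (x v w : Coord 3) :
    metricInner solMetric x v w = Real.exp (2 * x 2) * v 0 * w 0
      + Real.exp (-2 * x 2) * v 1 * w 1 + v 2 * w 2 := by
  simp [metricInner, solMetric, Fin.sum_univ_three, Matrix.diagonal]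

theorem solMetric_inv (x : Coord 3) :
    (solMetric x)⁻¹ = Matrix.diagonal ![Real.exp (-2 * x 2), Real.exp (2 * x 2), 1] := by
  apply Matrix.inv_eq_right_inv
  rw [solMetric, Matrix.diagonal_mul_diagonal, ← Matrix.diagonal_one]
  congr 1
  funext a
  fin_cases a <;> simp [← Real.exp_add]

theorem partialD_solMetric (x : Coord 3) (i a b : Fin 3) :
    partialD i (fun y => solMetric y a b) x
      = if i = 2 ∧ a = 0 ∧ b = 0 then 2 * Real.exp (2 * x 2)
        else if i = 2 ∧ a = 1 ∧ b = 1 then -2 * Real.exp (-2 * x 2) else 0 := by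
  have hc : DifferentiableAt ℝ (fun y : Coord 3 => y 2) x :=
    differentiableAt_coord differentiableAt_id 2
  have h2 : partialD i (fun y : Coord 3 => y 2) x = if i = 2 then 1 else 0 := by
    rw [partialD_coord (F := fun y => y) differentiableAt_id]
    simp [partialD, eq_comm]
  have hexp : ∀ r : ℝ, partialD i (fun y : Coord 3 => Real.exp (r * y 2)) x
      = if i = 2 then r * Real.exp (r * x 2) else 0 := by
    intro r
    rw [partialD_exp (hc.const_mul r), partialD_const_mul r hc, h2]
    split_ifs <;> ring
  have e := hexp (-2)
  simp only [neg_mul] at e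
  fin_cases a <;> fin_cases b <;> simp [solMetric, Matrix.diagonal, partialD_const, hexp, e]

/-- With indices 0, 1, 2 for x, y, z, the nonzero Christoffel symbols of Sol are Γ⁰₀₂ = Γ⁰₂₀ = 1,
Γ¹₁₂ = Γ¹₂₁ = -1, Γ²₀₀ = -e^{2z} and Γ²₁₁ = e^{-2z}. This and the next two formulas turn all later
ambient computations into polynomial identities in partial derivatives and exponentials. -/
theorem covDeriv_solMetric_zero {m : ℕ} (X V : Coord m → Coord 3) (i : Fin m) (u : Coord m) :
    covDeriv solMetric X V i u 0 = partialD i V u 0 + partialD i X u 0 * V u 2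
      + partialD i X u 2 * V u 0 := by
  simp [covDeriv, christoffel, solMetric_inv, partialD_solMetric, Fin.sum_univ_three,
    Matrix.diagonal]
  have : Real.exp (-(2 * X u 2)) * Real.exp (2 * X u 2) = 1 := by simp [← Real.exp_add]
  linear_combination (partialD i X u 0 * V u 2 + partialD i X u 2 * V u 0) * this

theorem covDeriv_solMetric_one {m : ℕ} (X V : Coord m → Coord 3) (i : Fin m) (u : Coord m) :
    covDeriv solMetric X V i u 1 = partialD i V u 1 - partialD i X u 1 * V u 2
      - partialD i X u 2 * V u 1 := by
  simp [covDeriv, christoffel, solMetric_inv, partialD_solMetric, Fin.sum_univ_three,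
    Matrix.diagonal]
  have : Real.exp (-(2 * X u 2)) * Real.exp (2 * X u 2) = 1 := by simp [← Real.exp_add]
  linear_combination (-partialD i X u 1 * V u 2 - partialD i X u 2 * V u 1) * this

theorem covDeriv_solMetric_two {m : ℕ} (X V : Coord m → Coord 3) (i : Fin m) (u : Coord m) :
    covDeriv solMetric X V i u 2 = partialD i V u 2
      - Real.exp (2 * X u 2) * partialD i X u 0 * V u 0
      + Real.exp (-2 * X u 2) * partialD i X u 1 * V u 1 := by
  simp [covDeriv, christoffel, solMetric_inv, partialD_solMetric, Fin.sum_univ_three,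
    Matrix.diagonal]
  ring

/-- The Levi-Civita connection of Sol is compatible with the metric. -/
theorem partialD_metricInner_solMetric {m : ℕ} {X V W : Coord m → Coord 3} {u : Coord m}
    (hX : DifferentiableAt ℝ X u) (hV : DifferentiableAt ℝ V u) (hW : DifferentiableAt ℝ W u)
    (i : Fin m) :
    partialD i (fun y => metricInner solMetric (X y) (V y) (W y)) u
      = metricInner solMetric (X u) (covDeriv solMetric X V i u) (W u)
        + metricInner solMetric (X u) (V u) (covDeriv solMetric X W i u) := by
  have hx := differentiableAt_coord hX 2
  have hv := differentiableAt_coord hV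
  have hw := differentiableAt_coord hW
  have d1 : DifferentiableAt ℝ (fun y => Real.exp (2 * X y 2)) u := (hx.const_mul 2).exp
  have d2 : DifferentiableAt ℝ (fun y => Real.exp (-2 * X y 2)) u := (hx.const_mul (-2)).exp
  simp only [metricInner_solMetric, covDeriv_solMetric_zero, covDeriv_solMetric_one,
    covDeriv_solMetric_two]
  rw [partialD_add (((d1.fun_mul (hv 0)).fun_mul (hw 0)).fun_add
      ((d2.fun_mul (hv 1)).fun_mul (hw 1))) ((hv 2).fun_mul (hw 2)),
    partialD_add ((d1.fun_mul (hv 0)).fun_mul (hw 0)) ((d2.fun_mul (hv 1)).fun_mul (hw 1)),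
    partialD_mul (d1.fun_mul (hv 0)) (hw 0), partialD_mul (d2.fun_mul (hv 1)) (hw 1),
    partialD_mul d1 (hv 0), partialD_mul d2 (hv 1), partialD_mul (hv 2) (hw 2),
    partialD_exp (hx.const_mul 2), partialD_exp (hx.const_mul (-2)), partialD_const_mul 2 hx,
    partialD_const_mul (-2) hx]
  simp only [partialD_coord hX, partialD_coord hV, partialD_coord hW]
  ring

/-- The Levi-Civita connection of Sol is torsion free. -/
theorem covDeriv_solMetric_comm {m : ℕ} {X : Coord m → Coord 3} {u : Coord m}
    (hX : ContDiffAt ℝ ∞ X u) (i j : Fin m) :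
    covDeriv solMetric X (partialD j X) i u = covDeriv solMetric X (partialD i X) j u := by
  have h := partialD_comm hX i j
  ext a
  fin_cases a <;> simp only [Fin.mk_zero, Fin.mk_one, Fin.reduceFinMk,
    covDeriv_solMetric_zero, covDeriv_solMetric_one, covDeriv_solMetric_two, h] <;> ring

theorem ContDiffAt.covDeriv_solMetric {m : ℕ} {X V : Coord m → Coord 3} {u : Coord m}
    (hX : ContDiffAt ℝ ∞ X u) (hV : ContDiffAt ℝ ∞ V u) (i : Fin m) :
    ContDiffAt ℝ ∞ (covDeriv solMetric X V i) u := by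
  have hx := contDiffAt_coord hX
  have hv := contDiffAt_coord hV
  have hx' := contDiffAt_coord (hX.partialD i)
  have hv' := contDiffAt_coord (hV.partialD i)
  refine (contDiffAt_euclidean (𝕜 := ℝ)).2 fun a => ?_
  fin_cases a
  · simp only [Fin.zero_eta, covDeriv_solMetric_zero]
    exact ((hv' 0).add ((hx' 0).mul (hv 2))).add ((hx' 2).mul (hv 0))
  · simp only [Fin.mk_one, covDeriv_solMetric_one]
    exact ((hv' 1).sub ((hx' 1).mul (hv 2))).sub ((hx' 2).mul (hv 1))
  · simp only [Fin.reduceFinMk, covDeriv_solMetric_two]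
    exact ((hv' 2).sub (((contDiffAt_const.mul (hx 2)).exp.mul (hx' 0)).mul (hv 0))).add
      (((contDiffAt_const.mul (hx 2)).exp.mul (hx' 1)).mul (hv 1))

/-- The curvature of Sol, with the sectional curvatures `1` in the plane `z = const` and `-1` in
the vertical coordinate planes. -/
theorem metricInner_curvature_solMetric {m : ℕ} {X V : Coord m → Coord 3} {u : Coord m}
    (hX : ContDiffAt ℝ ∞ X u) (hV : ContDiffAt ℝ ∞ V u) (i j : Fin m) (n : Coord 3) :
    metricInner solMetric (X u) n (covDeriv solMetric X (covDeriv solMetric X V j) i u)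
      - metricInner solMetric (X u) n (covDeriv solMetric X (covDeriv solMetric X V i) j u)
    = -Real.exp (-2 * X u 2)
          * (partialD i X u 1 * partialD j X u 2 - partialD i X u 2 * partialD j X u 1)
          * (n 1 * V u 2 - n 2 * V u 1)
      - Real.exp (2 * X u 2)
          * (partialD i X u 2 * partialD j X u 0 - partialD i X u 0 * partialD j X u 2)
          * (n 2 * V u 0 - n 0 * V u 2)
      + (partialD i X u 0 * partialD j X u 1 - partialD i X u 1 * partialD j X u 0)
          * (n 0 * V u 1 - n 1 * V u 0) := by
  have hXd := hX.differentiableAt_of_infty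
  have hVd := hV.differentiableAt_of_infty
  have hx := differentiableAt_coord hXd
  have hv := differentiableAt_coord hVd
  have hx' := fun k => differentiableAt_coord (hX.partialD k).differentiableAt_of_infty
  have hv' := fun k => differentiableAt_coord (hV.partialD k).differentiableAt_of_infty
  have d1 : DifferentiableAt ℝ (fun y => Real.exp (2 * X y 2)) u := ((hx 2).const_mul 2).exp
  have d2 : DifferentiableAt ℝ (fun y => Real.exp (-2 * X y 2)) u := ((hx 2).const_mul (-2)).exp
  have key0 : ∀ k l, partialD l (covDeriv solMetric X V k) u 0
      = partialD l (partialD k V) u 0 + (partialD l (partialD k X) u 0 * V u 2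
        + partialD k X u 0 * partialD l V u 2) + (partialD l (partialD k X) u 2 * V u 0
        + partialD k X u 2 * partialD l V u 0) := by
    intro k l
    rw [← partialD_coord (hX.covDeriv_solMetric hV k).differentiableAt_of_infty]
    simp only [covDeriv_solMetric_zero]
    rw [partialD_add ((hv' k 0).fun_add ((hx' k 0).fun_mul (hv 2))) ((hx' k 2).fun_mul (hv 0)),
      partialD_add (hv' k 0) ((hx' k 0).fun_mul (hv 2)), partialD_mul (hx' k 0) (hv 2),
      partialD_mul (hx' k 2) (hv 0)]
    simp only [partialD_coord hVd, partialD_coord (hX.partialD k).differentiableAt_of_infty,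
      partialD_coord (hV.partialD k).differentiableAt_of_infty]
  have key1 : ∀ k l, partialD l (covDeriv solMetric X V k) u 1
      = partialD l (partialD k V) u 1 - (partialD l (partialD k X) u 1 * V u 2
        + partialD k X u 1 * partialD l V u 2) - (partialD l (partialD k X) u 2 * V u 1
        + partialD k X u 2 * partialD l V u 1) := by
    intro k l
    rw [← partialD_coord (hX.covDeriv_solMetric hV k).differentiableAt_of_infty]
    simp only [covDeriv_solMetric_one]
    rw [partialD_sub ((hv' k 1).fun_sub ((hx' k 1).fun_mul (hv 2))) ((hx' k 2).fun_mul (hv 1)),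
      partialD_sub (hv' k 1) ((hx' k 1).fun_mul (hv 2)), partialD_mul (hx' k 1) (hv 2),
      partialD_mul (hx' k 2) (hv 1)]
    simp only [partialD_coord hVd, partialD_coord (hX.partialD k).differentiableAt_of_infty,
      partialD_coord (hV.partialD k).differentiableAt_of_infty]
  have key2 : ∀ k l, partialD l (covDeriv solMetric X V k) u 2
      = partialD l (partialD k V) u 2
        - ((Real.exp (2 * X u 2) * (2 * partialD l X u 2) * partialD k X u 0
          + Real.exp (2 * X u 2) * partialD l (partialD k X) u 0) * V u 0
          + Real.exp (2 * X u 2) * partialD k X u 0 * partialD l V u 0)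
        + ((Real.exp (-2 * X u 2) * (-2 * partialD l X u 2) * partialD k X u 1
          + Real.exp (-2 * X u 2) * partialD l (partialD k X) u 1) * V u 1
          + Real.exp (-2 * X u 2) * partialD k X u 1 * partialD l V u 1) := by
    intro k l
    rw [← partialD_coord (hX.covDeriv_solMetric hV k).differentiableAt_of_infty]
    simp only [covDeriv_solMetric_two]
    rw [partialD_add ((hv' k 2).fun_sub ((d1.fun_mul (hx' k 0)).fun_mul (hv 0)))
        ((d2.fun_mul (hx' k 1)).fun_mul (hv 1)),
      partialD_sub (hv' k 2) ((d1.fun_mul (hx' k 0)).fun_mul (hv 0)),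
      partialD_mul (d1.fun_mul (hx' k 0)) (hv 0), partialD_mul (d2.fun_mul (hx' k 1)) (hv 1),
      partialD_mul d1 (hx' k 0), partialD_mul d2 (hx' k 1),
      partialD_exp ((hx 2).const_mul 2), partialD_exp ((hx 2).const_mul (-2)),
      partialD_const_mul 2 (hx 2), partialD_const_mul (-2) (hx 2)]
    simp only [partialD_coord hXd, partialD_coord hVd,
      partialD_coord (hX.partialD k).differentiableAt_of_infty,
      partialD_coord (hV.partialD k).differentiableAt_of_infty]
  have hEF : Real.exp (2 * X u 2) * Real.exp (-2 * X u 2) = 1 := by simp [← Real.exp_add]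
  simp only [metricInner_solMetric, covDeriv_solMetric_zero, covDeriv_solMetric_one,
    covDeriv_solMetric_two, key0, key1, key2, partialD_comm hX i j, partialD_comm hV i j]
  -- Second derivatives cancel by symmetry. The relation e^{2z}e^{-2z} = 1 is needed only for the
  -- curvature term of the horizontal plane.
  linear_combination ((partialD i X u 0 * partialD j X u 1 - partialD i X u 1 * partialD j X u 0)
          * (n 0 * V u 1 - n 1 * V u 0)) * hEF

/-! ### Parametrized surfaces in Sol -/

theorem metricInner_solMetric_comm (x v w : Coord 3) :
    metricInner solMetric x v w = metricInner solMetric x w v := by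
  simp only [metricInner_solMetric]; ring

theorem metricInner_solMetric_self_eq_zero {x v : Coord 3}
    (h : metricInner solMetric x v v = 0) : v = 0 := by
  rw [metricInner_solMetric] at h
  have h0 : 0 ≤ Real.exp (2 * x 2) * v 0 * v 0 := by
    rw [mul_assoc]; exact mul_nonneg (Real.exp_pos _).le (mul_self_nonneg _)
  have h1 : 0 ≤ Real.exp (-2 * x 2) * v 1 * v 1 := by
    rw [mul_assoc]; exact mul_nonneg (Real.exp_pos _).le (mul_self_nonneg _)
  have h2 := mul_self_nonneg (v 2)
  have e0 : Real.exp (2 * x 2) * v 0 * v 0 = 0 := by linarith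
  have e1 : Real.exp (-2 * x 2) * v 1 * v 1 = 0 := by linarith
  have e2 : v 2 * v 2 = 0 := by linarith
  ext a
  fin_cases a
  · simpa [Real.exp_ne_zero] using e0
  · simpa [Real.exp_ne_zero] using e1
  · simpa using e2

theorem metricInner_solMetric_add_left (x v v' w : Coord 3) :
    metricInner solMetric x (v + v') w
      = metricInner solMetric x v w + metricInner solMetric x v' w := by
  simp only [metricInner_solMetric, PiLp.add_apply]; ring

theorem metricInner_solMetric_sub_left (x v v' w : Coord 3) :
    metricInner solMetric x (v - v') w
      = metricInner solMetric x v w - metricInner solMetric x v' w := by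
  simp only [metricInner_solMetric, PiLp.sub_apply]; ring

theorem metricInner_solMetric_smul_left (x v w : Coord 3) (a : ℝ) :
    metricInner solMetric x (a • v) w = a * metricInner solMetric x v w := by
  simp only [metricInner_solMetric, PiLp.smul_apply, smul_eq_mul]; ring

theorem metricInner_solMetric_smul_right (x v w : Coord 3) (a : ℝ) :
    metricInner solMetric x v (a • w) = a * metricInner solMetric x v w := by
  simp only [metricInner_solMetric, PiLp.smul_apply, smul_eq_mul]; ring

theorem metricInner_solMetric_smul_add_smul (x v w : Coord 3) (a b : ℝ) :
    metricInner solMetric x (a • v + b • w) (a • v + b • w)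
      = a ^ 2 * metricInner solMetric x v v + 2 * a * b * metricInner solMetric x v w
        + b ^ 2 * metricInner solMetric x w w := by
  simp only [metricInner_solMetric, PiLp.smul_apply, PiLp.add_apply, smul_eq_mul]; ring

/-- The determinant of the coordinates of three tangent vectors. -/
def coordDet (v w n : Coord 3) : ℝ :=
  v 0 * (w 1 * n 2 - w 2 * n 1) - v 1 * (w 0 * n 2 - w 2 * n 0) + v 2 * (w 0 * n 1 - w 1 * n 0)

/-- The Gram determinant; the volume form of Sol is `dx ∧ dy ∧ dz`. -/
theorem coordDet_sq (x v w n : Coord 3) :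
    coordDet v w n ^ 2
      = metricInner solMetric x v v * (metricInner solMetric x w w * metricInner solMetric x n n
          - metricInner solMetric x n w ^ 2)
        - metricInner solMetric x v w * (metricInner solMetric x v w * metricInner solMetric x n n
          - metricInner solMetric x n w * metricInner solMetric x n v)
        + metricInner solMetric x n v * (metricInner solMetric x v w * metricInner solMetric x n w
          - metricInner solMetric x w w * metricInner solMetric x n v) := by
  have hEF : Real.exp (2 * x 2) * Real.exp (-2 * x 2) = 1 := by simp [← Real.exp_add]
  simp only [metricInner_solMetric, coordDet]
  linear_combination (-(v 0 * (w 1 * n 2 - w 2 * n 1) - v 1 * (w 0 * n 2 - w 2 * n 0)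
    + v 2 * (w 0 * n 1 - w 1 * n 0)) ^ 2) * hEF

/-- Cramer's rule for the covector dual to y: each of its components times the determinant is a
cofactor combination of the three pairings. This is how vector identities are later checked against
the frame ∂₀, ∂₁, ξ. -/
theorem eq_zero_of_metricInner_solMetric {x v w n y : Coord 3} (hd : coordDet v w n ≠ 0)
    (hv : metricInner solMetric x y v = 0) (hw : metricInner solMetric x y w = 0)
    (hn : metricInner solMetric x y n = 0) : y = 0 := by
  rw [metricInner_solMetric] at hv hw hn
  have hE := Real.exp_ne_zero (2 * x 2)
  have hF := Real.exp_ne_zero (-2 * x 2)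
  unfold coordDet at hd
  have e0 : (Real.exp (2 * x 2) * y 0) = 0 := by
    refine (mul_eq_zero.1 ?_).resolve_left hd
    linear_combination (w 1 * n 2 - w 2 * n 1) * hv - (v 1 * n 2 - v 2 * n 1) * hw
      + (v 1 * w 2 - v 2 * w 1) * hn
  have e1 : (Real.exp (-2 * x 2) * y 1) = 0 := by
    refine (mul_eq_zero.1 ?_).resolve_left hd
    linear_combination -(w 0 * n 2 - w 2 * n 0) * hv + (v 0 * n 2 - v 2 * n 0) * hw
      - (v 0 * w 2 - v 2 * w 0) * hn
  have e2 : y 2 = 0 := by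
    refine (mul_eq_zero.1 ?_).resolve_left hd
    linear_combination (w 0 * n 1 - w 1 * n 0) * hv - (v 0 * n 1 - v 1 * n 0) * hw
      + (v 0 * w 1 - v 1 * w 0) * hn
  ext a
  fin_cases a
  · simpa [hE] using e0
  · simpa [hF] using e1
  · exact e2

/-- `X` is a smooth immersion of the open set `U` into Sol, with smooth unit normal `ξ`. -/
structure IsLocalSurface (U : Set (Coord 2)) (X ξ : Coord 2 → Coord 3) : Prop where
  isOpen : IsOpen U
  smooth : ∀ u ∈ U, ContDiffAt ℝ ∞ X u
  normal_smooth : ∀ u ∈ U, ContDiffAt ℝ ∞ ξ u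
  immersion : ∀ u ∈ U, ∀ a b : ℝ, a • partialD 0 X u + b • partialD 1 X u = 0 → a = 0 ∧ b = 0
  unit : ∀ u ∈ U, metricInner solMetric (X u) (ξ u) (ξ u) = 1
  orthogonal : ∀ u ∈ U, ∀ i, metricInner solMetric (X u) (ξ u) (partialD i X u) = 0

/-- The second fundamental form `⟨A ∂ᵢ, ∂ⱼ⟩ = -⟨∇ᵢ ξ, ∂ⱼ⟩` of a parametrized surface in Sol. -/
def secondForm (X ξ : Coord 2 → Coord 3) (i j : Fin 2) (u : Coord 2) : ℝ :=
  - metricInner solMetric (X u) (covDeriv solMetric X ξ i u) (partialD j X u)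

theorem inducedMetric_apply (X : Coord 2 → Coord 3) (u : Coord 2) (i j : Fin 2) :
    inducedMetric solMetric X u i j
      = metricInner solMetric (X u) (partialD i X u) (partialD j X u) := rfl

theorem inducedMetric_comm (X : Coord 2 → Coord 3) (u : Coord 2) (i j : Fin 2) :
    inducedMetric solMetric X u i j = inducedMetric solMetric X u j i :=
  metricInner_solMetric_comm _ _ _

theorem ContDiffAt.metricInner_solMetric {X V W : Coord 2 → Coord 3} {u : Coord 2}
    (hX : ContDiffAt ℝ ∞ X u) (hV : ContDiffAt ℝ ∞ V u) (hW : ContDiffAt ℝ ∞ W u) :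
    ContDiffAt ℝ ∞ (fun y => metricInner solMetric (X y) (V y) (W y)) u := by
  have hx := contDiffAt_coord hX
  have hv := contDiffAt_coord hV
  have hw := contDiffAt_coord hW
  simp only [_root_.metricInner_solMetric]
  exact ((((contDiffAt_const.mul (hx 2)).exp.mul (hv 0)).mul (hw 0)).add
    (((contDiffAt_const.mul (hx 2)).exp.mul (hv 1)).mul (hw 1))).add ((hv 2).mul (hw 2))

namespace IsLocalSurface

variable {U : Set (Coord 2)} {X ξ : Coord 2 → Coord 3} {u : Coord 2}

theorem eventually_mem (S : IsLocalSurface U X ξ) (hu : u ∈ U) : ∀ᶠ y in nhds u, y ∈ U :=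
  S.isOpen.mem_nhds hu

theorem det_ne_zero (S : IsLocalSurface U X ξ) (hu : u ∈ U) :
    (inducedMetric solMetric X u).det ≠ 0 := by
  intro h
  rw [Matrix.det_fin_two, inducedMetric_comm X u 1 0] at h
  set g := inducedMetric solMetric X u with hg
  -- The vector g₁₁∂₀ - g₀₁∂₁ has squared length g₁₁ det g, so a vanishing determinant would give a
  -- linear relation between the two tangent vectors.
  have key : metricInner solMetric (X u) (g 1 1 • partialD 0 X u + (-g 0 1) • partialD 1 X u)
      (g 1 1 • partialD 0 X u + (-g 0 1) • partialD 1 X u) = 0 := by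
    rw [metricInner_solMetric_smul_add_smul]
    simp only [← inducedMetric_apply, ← hg]
    linear_combination g 1 1 * h
  have h1 := (S.immersion u hu _ _ (metricInner_solMetric_self_eq_zero key)).1
  have h2 : partialD 1 X u = 0 := metricInner_solMetric_self_eq_zero h1
  have := (S.immersion u hu 0 1 (by simp [h2])).2
  exact one_ne_zero this

theorem coordDet_ne_zero (S : IsLocalSurface U X ξ) (hu : u ∈ U) :
    coordDet (partialD 0 X u) (partialD 1 X u) (ξ u) ≠ 0 := by
  intro h
  have h2 := coordDet_sq (X u) (partialD 0 X u) (partialD 1 X u) (ξ u)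
  rw [h, S.unit u hu, S.orthogonal u hu 0, S.orthogonal u hu 1] at h2
  apply S.det_ne_zero hu
  rw [Matrix.det_fin_two, inducedMetric_comm X u 1 0]
  simp only [inducedMetric_apply]
  linear_combination -h2

theorem mul_inv_sum (S : IsLocalSurface U X ξ) (hu : u ∈ U) (i j : Fin 2) :
    ∑ k, inducedMetric solMetric X u i k * (inducedMetric solMetric X u)⁻¹ k j
      = if i = j then 1 else 0 := by
  have h := Matrix.mul_nonsing_inv _ (isUnit_iff_ne_zero.2 (S.det_ne_zero hu))
  rw [← Matrix.mul_apply, h, Matrix.one_apply]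

/-- Metric compatibility, for the coefficients of the induced metric. -/
theorem partialD_inducedMetric (S : IsLocalSurface U X ξ) (hu : u ∈ U) (i j k : Fin 2) :
    partialD i (fun y => inducedMetric solMetric X y j k) u
      = metricInner solMetric (X u) (covDeriv solMetric X (partialD j X) i u) (partialD k X u)
        + metricInner solMetric (X u) (covDeriv solMetric X (partialD k X) i u)
          (partialD j X u) := by
  have hX := S.smooth u hu
  rw [metricInner_solMetric_comm _ _ (partialD j X u)]
  exact partialD_metricInner_solMetric hX.differentiableAt_of_infty
    (hX.partialD j).differentiableAt_of_infty (hX.partialD k).differentiableAt_of_infty i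

/-- The Koszul formula: after metric compatibility, torsion-freeness makes four of the six terms
cancel and the other two coincide. So the induced connection is the tangential part of the ambient
one. -/
theorem christoffel_eq (S : IsLocalSurface U X ξ) (hu : u ∈ U) (i j k : Fin 2) :
    christoffel (inducedMetric solMetric X) u k i j
      = ∑ l, (inducedMetric solMetric X u)⁻¹ k l *
        metricInner solMetric (X u) (covDeriv solMetric X (partialD j X) i u)
          (partialD l X u) := by
  have hX := S.smooth u hu
  rw [christoffel, Finset.mul_sum]
  refine Finset.sum_congr rfl fun l _ => ?_
  rw [S.partialD_inducedMetric hu, S.partialD_inducedMetric hu, S.partialD_inducedMetric hu,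
    covDeriv_solMetric_comm hX j i, covDeriv_solMetric_comm hX l i,
    covDeriv_solMetric_comm hX l j]
  ring

theorem sum_christoffel_mul (S : IsLocalSurface U X ξ) (hu : u ∈ U) (i j l : Fin 2) :
    ∑ k, christoffel (inducedMetric solMetric X) u k i j * inducedMetric solMetric X u k l
      = metricInner solMetric (X u) (covDeriv solMetric X (partialD j X) i u)
          (partialD l X u) := by
  have h0 := S.mul_inv_sum hu l 0
  have h1 := S.mul_inv_sum hu l 1
  simp only [S.christoffel_eq hu, Fin.sum_univ_two] at h0 h1 ⊢
  rw [inducedMetric_comm X u 0 l, inducedMetric_comm X u 1 l]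
  set a := metricInner solMetric (X u) (covDeriv solMetric X (partialD j X) i u)
    (partialD 0 X u) with ha
  set b := metricInner solMetric (X u) (covDeriv solMetric X (partialD j X) i u)
    (partialD 1 X u) with hb
  fin_cases l <;> simp [← ha, ← hb] at h0 h1 ⊢ <;> linear_combination a * h0 + b * h1

/-- Differentiate ⟨ξ, ∂ⱼX⟩ = 0. In this form the symmetry of the second fundamental form is just
torsion-freeness. -/
theorem secondForm_eq (S : IsLocalSurface U X ξ) (hu : u ∈ U) (i j : Fin 2) :
    secondForm X ξ i j u
      = metricInner solMetric (X u) (covDeriv solMetric X (partialD j X) i u) (ξ u) := by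
  have hX := S.smooth u hu
  have h := partialD_metricInner_solMetric hX.differentiableAt_of_infty
    (S.normal_smooth u hu).differentiableAt_of_infty (hX.partialD j).differentiableAt_of_infty i
  have h0 : (fun y => metricInner solMetric (X y) (ξ y) (partialD j X y))
      =ᶠ[nhds u] fun _ => (0 : ℝ) := by
    filter_upwards [S.eventually_mem hu] with y hy using S.orthogonal y hy j
  rw [partialD_congr h0, partialD_const] at h
  rw [secondForm, metricInner_solMetric_comm _ _ (ξ u)]
  linarith

theorem secondForm_comm (S : IsLocalSurface U X ξ) (hu : u ∈ U) (i j : Fin 2) :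
    secondForm X ξ i j u = secondForm X ξ j i u := by
  rw [S.secondForm_eq hu, S.secondForm_eq hu, covDeriv_solMetric_comm (S.smooth u hu)]

theorem metricInner_covDeriv_normal (S : IsLocalSurface U X ξ) (hu : u ∈ U) (i : Fin 2) :
    metricInner solMetric (X u) (covDeriv solMetric X ξ i u) (ξ u) = 0 := by
  have hξ := (S.normal_smooth u hu).differentiableAt_of_infty
  have h := partialD_metricInner_solMetric (S.smooth u hu).differentiableAt_of_infty hξ hξ i
  have h0 : (fun y => metricInner solMetric (X y) (ξ y) (ξ y)) =ᶠ[nhds u] fun _ => (1 : ℝ) := by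
    filter_upwards [S.eventually_mem hu] with y hy using S.unit y hy
  rw [partialD_congr h0, partialD_const, metricInner_solMetric_comm _ (ξ u)] at h
  linarith

/-- The Gauss formula. -/
theorem covDeriv_partialD_eq (S : IsLocalSurface U X ξ) (hu : u ∈ U) (i j : Fin 2) :
    covDeriv solMetric X (partialD j X) i u
      = (∑ k, christoffel (inducedMetric solMetric X) u k i j • partialD k X u)
        + secondForm X ξ i j u • ξ u := by
  rw [← sub_eq_zero]
  have key : ∀ l, metricInner solMetric (X u) (covDeriv solMetric X (partialD j X) i u
      - ((∑ k, christoffel (inducedMetric solMetric X) u k i j • partialD k X u)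
        + secondForm X ξ i j u • ξ u)) (partialD l X u) = 0 := by
    intro l
    have h := S.sum_christoffel_mul hu i j l
    simp only [Fin.sum_univ_two, metricInner_solMetric_sub_left, metricInner_solMetric_add_left,
      metricInner_solMetric_smul_left, S.orthogonal u hu, inducedMetric_apply] at h ⊢
    linarith
  refine eq_zero_of_metricInner_solMetric (S.coordDet_ne_zero hu) (key 0) (key 1) ?_
  have h : ∀ k, metricInner solMetric (X u) (partialD k X u) (ξ u) = 0 := fun k => by
    rw [metricInner_solMetric_comm, S.orthogonal u hu]
  simp only [Fin.sum_univ_two, metricInner_solMetric_sub_left, metricInner_solMetric_add_left,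
    metricInner_solMetric_smul_left, S.unit u hu, h, ← S.secondForm_eq hu]
  ring

theorem two_mul_meanCurvature (X ξ : Coord 2 → Coord 3) (u : Coord 2) :
    ∑ i, ∑ j, (inducedMetric solMetric X u)⁻¹ i j * secondForm X ξ i j u
      = 2 * meanCurvature solMetric X ξ u := by
  simp [meanCurvature, shapeOperator, Matrix.trace, Fin.sum_univ_two, secondForm]

/-- By the Gauss formula, subtracting the intrinsic Christoffel terms leaves only the normal part,
whose trace is 2f. -/
theorem tensionField_eq (S : IsLocalSurface U X ξ) (hu : u ∈ U) :
    tensionField solMetric X u = (2 * meanCurvature solMetric X ξ u) • ξ u := by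
  rw [← two_mul_meanCurvature, tensionField, Finset.sum_smul]
  refine Finset.sum_congr rfl fun i _ => ?_
  rw [Finset.sum_smul]
  refine Finset.sum_congr rfl fun j _ => ?_
  rw [S.covDeriv_partialD_eq hu, add_sub_cancel_left, smul_smul]

theorem covDeriv_const_smul_normal (S : IsLocalSurface U X ξ) (hu : u ∈ U) (c : ℝ) (i : Fin 2) :
    covDeriv solMetric X (fun y => c • ξ y) i u = c • covDeriv solMetric X ξ i u := by
  have h : partialD i (fun y => c • ξ y) u = c • partialD i ξ u := by
    unfold partialD
    rw [fderiv_fun_const_smul (S.normal_smooth u hu).differentiableAt_of_infty]; rfl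
  ext a
  fin_cases a <;> simp [covDeriv_solMetric_zero, covDeriv_solMetric_one,
    covDeriv_solMetric_two, h] <;> ring

/-- With τ = 2cξ, one has ⟨∂ₖX, ∇ₗτ⟩ = -2c hₗₖ, whose trace is -4c². Together with ½|τ|² = 2c² this
gives the coefficient -2c² of the metric. -/
theorem stressBienergy_eq (S : IsLocalSurface U X ξ) {c : ℝ}
    (hc : ∀ u ∈ U, meanCurvature solMetric X ξ u = c) (hu : u ∈ U) (i j : Fin 2) :
    stressBienergy solMetric X i j u
      = -2 * c ^ 2 * inducedMetric solMetric X u i j + 4 * c * secondForm X ξ i j u := by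
  have ht : tensionField solMetric X =ᶠ[nhds u] fun y => (2 * c) • ξ y := by
    filter_upwards [S.eventually_mem hu] with y hy
    rw [S.tensionField_eq hy, hc y hy]
  have hcov : ∀ k, covDeriv solMetric X (tensionField solMetric X) k u
      = (2 * c) • covDeriv solMetric X ξ k u := by
    intro k
    rw [← S.covDeriv_const_smul_normal hu]
    simp only [covDeriv, partialD_congr ht, ht.eq_of_nhds]
  have hA : ∀ k l, metricInner solMetric (X u) (partialD k X u)
      (covDeriv solMetric X (tensionField solMetric X) l u)
        = -(2 * c) * secondForm X ξ l k u := by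
    intro k l
    rw [hcov, metricInner_solMetric_smul_right, metricInner_solMetric_comm, secondForm]
    ring
  have htr := two_mul_meanCurvature X ξ u
  rw [hc u hu] at htr
  simp only [stressBienergy, hA, ht.eq_of_nhds, metricInner_solMetric_smul_left,
    metricInner_solMetric_smul_right, S.unit u hu]
  rw [S.secondForm_comm hu j i]
  simp only [Fin.sum_univ_two, S.secondForm_comm hu 1 0] at htr ⊢
  linear_combination (-2 * c * inducedMetric solMetric X u i j) * htr

end IsLocalSurface

/-! ### The divergence of the stress-energy tensor -/

/-- The components `(∇ᵢ T)(∂ⱼ, ∂ₖ)` of the covariant derivative of a 2-tensor `T`. -/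
def covDerivTensor {m : ℕ} (g : Coord m → Matrix (Fin m) (Fin m) ℝ)
    (T : Fin m → Fin m → Coord m → ℝ) (i j k : Fin m) (u : Coord m) : ℝ :=
  partialD i (T j k) u - (∑ l, christoffel g u l i j * T l k u)
    - ∑ l, christoffel g u l i k * T j l u

namespace IsLocalSurface

variable {U : Set (Coord 2)} {X ξ : Coord 2 → Coord 3} {u : Coord 2}

theorem contDiffAt_inducedMetric (S : IsLocalSurface U X ξ) (hu : u ∈ U) (i j : Fin 2) :
    ContDiffAt ℝ ∞ (fun y => inducedMetric solMetric X y i j) u :=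
  (S.smooth u hu).metricInner_solMetric ((S.smooth u hu).partialD i) ((S.smooth u hu).partialD j)

theorem contDiffAt_secondForm (S : IsLocalSurface U X ξ) (hu : u ∈ U) (i j : Fin 2) :
    ContDiffAt ℝ ∞ (secondForm X ξ i j) u :=
  ((S.smooth u hu).metricInner_solMetric
    ((S.smooth u hu).covDeriv_solMetric (S.normal_smooth u hu) i)
    ((S.smooth u hu).partialD j)).neg

theorem covDerivTensor_inducedMetric (S : IsLocalSurface U X ξ) (hu : u ∈ U) (i j k : Fin 2) :
    covDerivTensor (inducedMetric solMetric X) (fun j k y => inducedMetric solMetric X y j k)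
      i j k u = 0 := by
  have h : ∀ l, inducedMetric solMetric X u j l = inducedMetric solMetric X u l j :=
    fun l => inducedMetric_comm X u j l
  simp only [covDerivTensor, S.partialD_inducedMetric hu, h, S.sum_christoffel_mul hu]
  ring

theorem covDerivTensor_secondForm_comm (S : IsLocalSurface U X ξ) (hu : u ∈ U) (i j k : Fin 2) :
    covDerivTensor (inducedMetric solMetric X) (secondForm X ξ) i j k u
      = covDerivTensor (inducedMetric solMetric X) (secondForm X ξ) i k j u := by
  have h : secondForm X ξ j k =ᶠ[nhds u] secondForm X ξ k j := by
    filter_upwards [S.eventually_mem hu] with y hy using S.secondForm_comm hy j k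
  simp only [covDerivTensor, partialD_congr h, S.secondForm_comm hu _ k, S.secondForm_comm hu _ j]
  ring

/-- Differentiate ⟨∇ⱼ∂ₖX, ξ⟩ and expand ∇ⱼ∂ₖX by the Gauss formula where it is paired with ∇ᵢξ: its
normal part drops out because ∇ᵢξ is tangent. In the Codazzi equation the remaining Christoffel
terms cancel, leaving a difference of second covariant derivatives. -/
theorem partialD_secondForm (S : IsLocalSurface U X ξ) (hu : u ∈ U) (i j k : Fin 2) :
    partialD i (secondForm X ξ j k) u
      = metricInner solMetric (X u) (ξ u)
          (covDeriv solMetric X (covDeriv solMetric X (partialD k X) j) i u)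
        - ∑ l, christoffel (inducedMetric solMetric X) u l j k * secondForm X ξ i l u := by
  have hX := S.smooth u hu
  have hξ := S.normal_smooth u hu
  have h : secondForm X ξ j k =ᶠ[nhds u] fun y => metricInner solMetric (X y)
      (covDeriv solMetric X (partialD k X) j y) (ξ y) := by
    filter_upwards [S.eventually_mem hu] with y hy using S.secondForm_eq hy j k
  rw [partialD_congr h, partialD_metricInner_solMetric hX.differentiableAt_of_infty
    (hX.covDeriv_solMetric (hX.partialD k) j).differentiableAt_of_infty
    hξ.differentiableAt_of_infty, metricInner_solMetric_comm _ _ (ξ u),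
    S.covDeriv_partialD_eq hu j k]
  simp only [Fin.sum_univ_two, metricInner_solMetric_add_left, metricInner_solMetric_smul_left,
    secondForm]
  rw [metricInner_solMetric_comm _ (ξ u) (covDeriv solMetric X ξ i u),
    S.metricInner_covDeriv_normal hu, metricInner_solMetric_comm _ (partialD 0 X u),
    metricInner_solMetric_comm _ (partialD 1 X u)]
  ring

/-- The Codazzi equation. -/
theorem codazzi (S : IsLocalSurface U X ξ) (hu : u ∈ U) (i j k : Fin 2) :
    covDerivTensor (inducedMetric solMetric X) (secondForm X ξ) i j k u
      - covDerivTensor (inducedMetric solMetric X) (secondForm X ξ) j i k u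
    = metricInner solMetric (X u) (ξ u)
          (covDeriv solMetric X (covDeriv solMetric X (partialD k X) j) i u)
      - metricInner solMetric (X u) (ξ u)
          (covDeriv solMetric X (covDeriv solMetric X (partialD k X) i) j u) := by
  have hΓ : ∀ l, christoffel (inducedMetric solMetric X) u l i j
      = christoffel (inducedMetric solMetric X) u l j i := fun l => by
    rw [S.christoffel_eq hu, S.christoffel_eq hu, covDeriv_solMetric_comm (S.smooth u hu)]
  simp only [covDerivTensor, S.partialD_secondForm hu, hΓ, Fin.sum_univ_two,
    S.secondForm_comm hu i, S.secondForm_comm hu j]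
  ring

theorem inv_inducedMetric (X : Coord 2 → Coord 3) (u : Coord 2) :
    (inducedMetric solMetric X u)⁻¹ = (inducedMetric solMetric X u).det⁻¹ •
      !![inducedMetric solMetric X u 1 1, -inducedMetric solMetric X u 0 1;
        -inducedMetric solMetric X u 0 1, inducedMetric solMetric X u 0 0] := by
  rw [Matrix.inv_def, Matrix.adjugate_fin_two, Ring.inverse_eq_inv, inducedMetric_comm X u 1 0]

/-- The trace identity multiplied by det g, so that it can be differentiated without differentiating
the inverse metric. -/
theorem trace_secondForm (S : IsLocalSurface U X ξ) (hu : u ∈ U) :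
    inducedMetric solMetric X u 1 1 * secondForm X ξ 0 0 u
      - 2 * (inducedMetric solMetric X u 0 1 * secondForm X ξ 0 1 u)
      + inducedMetric solMetric X u 0 0 * secondForm X ξ 1 1 u
    = 2 * meanCurvature solMetric X ξ u
      * (inducedMetric solMetric X u 0 0 * inducedMetric solMetric X u 1 1
        - inducedMetric solMetric X u 0 1 * inducedMetric solMetric X u 0 1) := by
  have hd := S.det_ne_zero hu
  have hdet : (inducedMetric solMetric X u).det = inducedMetric solMetric X u 0 0
      * inducedMetric solMetric X u 1 1
        - inducedMetric solMetric X u 0 1 * inducedMetric solMetric X u 0 1 := by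
    rw [Matrix.det_fin_two, inducedMetric_comm X u 1 0]
  rw [← hdet, ← two_mul_meanCurvature, inv_inducedMetric]
  simp only [Fin.sum_univ_two, S.secondForm_comm hu 1 0, Matrix.smul_apply, smul_eq_mul,
    Matrix.of_apply, Matrix.cons_val_zero, Matrix.cons_val_one]
  simp
  field_simp
  ring

/-- Tracing commutes with covariant differentiation, so this is det g times the derivative of the
constant trace 2c. -/
theorem trace_covDerivTensor_secondForm (S : IsLocalSurface U X ξ) {c : ℝ}
    (hc : ∀ u ∈ U, meanCurvature solMetric X ξ u = c) (hu : u ∈ U) (k : Fin 2) :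
    inducedMetric solMetric X u 1 1
        * covDerivTensor (inducedMetric solMetric X) (secondForm X ξ) k 0 0 u
      - 2 * (inducedMetric solMetric X u 0 1
        * covDerivTensor (inducedMetric solMetric X) (secondForm X ξ) k 0 1 u)
      + inducedMetric solMetric X u 0 0
        * covDerivTensor (inducedMetric solMetric X) (secondForm X ξ) k 1 1 u = 0 := by
  have hg := fun i j => (S.contDiffAt_inducedMetric hu i j).differentiableAt_of_infty
  have hh := fun i j => (S.contDiffAt_secondForm hu i j).differentiableAt_of_infty
  have h : (fun y => inducedMetric solMetric X y 1 1 * secondForm X ξ 0 0 y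
      - 2 * (inducedMetric solMetric X y 0 1 * secondForm X ξ 0 1 y)
      + inducedMetric solMetric X y 0 0 * secondForm X ξ 1 1 y) =ᶠ[nhds u] fun y => 2 * c
      * (inducedMetric solMetric X y 0 0 * inducedMetric solMetric X y 1 1
        - inducedMetric solMetric X y 0 1 * inducedMetric solMetric X y 0 1) := by
    filter_upwards [S.eventually_mem hu] with y hy
    rw [S.trace_secondForm hy, hc y hy]
  have h0 := h.eq_of_nhds
  have h1 := partialD_congr (i := k) h
  rw [partialD_add (((hg 1 1).fun_mul (hh 0 0)).fun_sub (((hg 0 1).fun_mul (hh 0 1)).const_mul 2))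
      ((hg 0 0).fun_mul (hh 1 1)),
    partialD_sub ((hg 1 1).fun_mul (hh 0 0)) (((hg 0 1).fun_mul (hh 0 1)).const_mul 2),
    partialD_const_mul 2 ((hg 0 1).fun_mul (hh 0 1)), partialD_mul (hg 1 1) (hh 0 0),
    partialD_mul (hg 0 1) (hh 0 1), partialD_mul (hg 0 0) (hh 1 1),
    partialD_const_mul (2 * c) (((hg 0 0).fun_mul (hg 1 1)).fun_sub ((hg 0 1).fun_mul (hg 0 1))),
    partialD_sub ((hg 0 0).fun_mul (hg 1 1)) ((hg 0 1).fun_mul (hg 0 1)),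
    partialD_mul (hg 0 0) (hg 1 1), partialD_mul (hg 0 1) (hg 0 1)] at h1
  have d : ∀ i j, partialD k (fun y => inducedMetric solMetric X y i j) u
      = (∑ l, christoffel (inducedMetric solMetric X) u l k i * inducedMetric solMetric X u l j)
        + ∑ l, christoffel (inducedMetric solMetric X) u l k j
          * inducedMetric solMetric X u l i := fun i j => by
    rw [S.sum_christoffel_mul hu, S.sum_christoffel_mul hu, S.partialD_inducedMetric hu]
  simp only [d, Fin.sum_univ_two, inducedMetric_comm X u 1 0] at h1
  simp only [covDerivTensor, Fin.sum_univ_two, S.secondForm_comm hu 1 0]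
  -- The multiple of `h0` compensates for the factor det g, since ∂ₖ det g = 2(Γ⁰ₖ₀ + Γ¹ₖ₁) det g.
  linear_combination h1 - 2 * (christoffel (inducedMetric solMetric X) u 0 k 0
    + christoffel (inducedMetric solMetric X) u 1 k 1) * h0

/-- The multiple of the metric in the stress-energy tensor is parallel, so only the divergence of
4ch survives. -/
theorem divTensor_stressBienergy (S : IsLocalSurface U X ξ) {c : ℝ}
    (hc : ∀ u ∈ U, meanCurvature solMetric X ξ u = c) (hu : u ∈ U) (k : Fin 2) :
    divTensor (inducedMetric solMetric X) (stressBienergy solMetric X) k u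
      = 4 * c * ∑ i, ∑ j, (inducedMetric solMetric X u)⁻¹ i j
        * covDerivTensor (inducedMetric solMetric X) (secondForm X ξ) i j k u := by
  rw [divTensor, Finset.mul_sum]
  refine Finset.sum_congr rfl fun i _ => ?_
  rw [Finset.mul_sum]
  refine Finset.sum_congr rfl fun j _ => ?_
  have h : stressBienergy solMetric X j k =ᶠ[nhds u] fun y =>
      (-2 * c ^ 2) * inducedMetric solMetric X y j k + (4 * c) * secondForm X ξ j k y := by
    filter_upwards [S.eventually_mem hu] with y hy using S.stressBienergy_eq hc hy j k
  have hg := (S.contDiffAt_inducedMetric hu j k).differentiableAt_of_infty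
  have hh := (S.contDiffAt_secondForm hu j k).differentiableAt_of_infty
  have h0 := S.covDerivTensor_inducedMetric hu i j k
  rw [partialD_congr h, partialD_add (hg.const_mul _) (hh.const_mul _),
    partialD_const_mul _ hg, partialD_const_mul _ hh]
  simp only [covDerivTensor, S.stressBienergy_eq hc hu, Fin.sum_univ_two] at h0 ⊢
  linear_combination (-2 * c ^ 2 * (inducedMetric solMetric X u)⁻¹ i j) * h0

/-- On a biconservative CMC surface that is not minimal the covariant derivative of the second
fundamental form is symmetric. -/
theorem covDerivTensor_secondForm_symm_of_divTensor_eq_zero (S : IsLocalSurface U X ξ) {c : ℝ}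
    (hc : ∀ u ∈ U, meanCurvature solMetric X ξ u = c) (hc0 : c ≠ 0) (hu : u ∈ U)
    (hdiv : ∀ k, divTensor (inducedMetric solMetric X) (stressBienergy solMetric X) k u = 0)
    (k : Fin 2) :
    covDerivTensor (inducedMetric solMetric X) (secondForm X ξ) 0 1 k u
      - covDerivTensor (inducedMetric solMetric X) (secondForm X ξ) 1 0 k u = 0 := by
  have hd := S.det_ne_zero hu
  -- The equation Div h = 0 multiplied by det g; this is where c ≠ 0 is used to cancel the factor
  -- 4c.
  have key : ∀ k, inducedMetric solMetric X u 1 1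
        * covDerivTensor (inducedMetric solMetric X) (secondForm X ξ) 0 0 k u
      - inducedMetric solMetric X u 0 1
        * (covDerivTensor (inducedMetric solMetric X) (secondForm X ξ) 0 1 k u
          + covDerivTensor (inducedMetric solMetric X) (secondForm X ξ) 1 0 k u)
      + inducedMetric solMetric X u 0 0
        * covDerivTensor (inducedMetric solMetric X) (secondForm X ξ) 1 1 k u = 0 := by
    intro k
    have h := hdiv k
    rw [S.divTensor_stressBienergy hc hu, inv_inducedMetric] at h
    simp [hc0, Fin.sum_univ_two] at h
    field_simp at h
    linear_combination h
  have k0 := key 0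
  have k1 := key 1
  have t0 := S.trace_covDerivTensor_secondForm hc hu 0
  have t1 := S.trace_covDerivTensor_secondForm hc hu 1
  rw [Matrix.det_fin_two, inducedMetric_comm X u 1 0] at hd
  rw [S.covDerivTensor_secondForm_comm hu 0 1 0, S.covDerivTensor_secondForm_comm hu 1 1 0] at k0
  -- Write Cₖ = ∇₀h₁ₖ - ∇₁h₀ₖ. The differences Div h - d(trace h) read g₀₁C₀ - g₀₀C₁ = 0 and g₁₁C₀ -
  -- g₀₁C₁ = 0, a linear system whose determinant is det g up to sign. This uses that the surface
  -- has dimension two.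
  have c0 : (inducedMetric solMetric X u 0 0 * inducedMetric solMetric X u 1 1
      - inducedMetric solMetric X u 0 1 * inducedMetric solMetric X u 0 1)
      * (covDerivTensor (inducedMetric solMetric X) (secondForm X ξ) 0 1 k u
      - covDerivTensor (inducedMetric solMetric X) (secondForm X ξ) 1 0 k u) = 0 := by
    fin_cases k <;> simp only [Fin.zero_eta, Fin.mk_one]
    · rw [S.covDerivTensor_secondForm_comm hu 0 1 0]
      linear_combination inducedMetric solMetric X u 0 0 * (k1 - t1)
        - inducedMetric solMetric X u 0 1 * (k0 - t0)
    · linear_combination inducedMetric solMetric X u 0 1 * (k1 - t1)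
        - inducedMetric solMetric X u 1 1 * (k0 - t0)
  exact (mul_eq_zero.1 c0).resolve_left hd

end IsLocalSurface

namespace IsLocalSurface

variable {U : Set (Coord 2)} {X ξ : Coord 2 → Coord 3} {u : Coord 2}

/-! ### The normal is vertical or horizontal -/

/-- Symmetry of ∇h and the Codazzi equation say that the ambient curvature R(∂₀,∂₁) maps tangent
vectors to tangent vectors. On bivectors the curvature of Sol is a multiple of the identity except
for the sign on the horizontal plane, so the condition only constrains the vertical component of ξ
against its horizontal part. -/
theorem normal_vertical_or_horizontal (S : IsLocalSurface U X ξ) {c : ℝ}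
    (hc : ∀ u ∈ U, meanCurvature solMetric X ξ u = c) (hc0 : c ≠ 0) (hu : u ∈ U)
    (hdiv : ∀ k, divTensor (inducedMetric solMetric X) (stressBienergy solMetric X) k u = 0) :
    ξ u 2 = 0 ∨ (ξ u 0 = 0 ∧ ξ u 1 = 0) := by
  have hX := S.smooth u hu
  have hΔ := S.coordDet_ne_zero hu
  have hEF : Real.exp (2 * X u 2) * Real.exp (-2 * X u 2) = 1 := by simp [← Real.exp_add]
  have hunit := S.unit u hu
  have horth := S.orthogonal u hu
  -- The Riemannian cross product of ∂₀X and ∂₁X is normal, with coefficient the volume of the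
  -- frame; it has the same pairings with ∂₀X, ∂₁X and ξ as the right-hand multiple of ξ.
  have hcross : WithLp.toLp 2 ![Real.exp (-2 * X u 2)
        * (partialD 0 X u 1 * partialD 1 X u 2 - partialD 0 X u 2 * partialD 1 X u 1),
      Real.exp (2 * X u 2)
        * (partialD 0 X u 2 * partialD 1 X u 0 - partialD 0 X u 0 * partialD 1 X u 2),
      partialD 0 X u 0 * partialD 1 X u 1 - partialD 0 X u 1 * partialD 1 X u 0]
      - coordDet (partialD 0 X u) (partialD 1 X u) (ξ u) • ξ u = 0 := by
    refine eq_zero_of_metricInner_solMetric (x := X u) hΔ ?_ ?_ ?_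
    all_goals
      rw [metricInner_solMetric_sub_left, metricInner_solMetric_smul_left]
      simp only [hunit, horth]
      simp only [metricInner_solMetric, Matrix.cons_val_zero, Matrix.cons_val_one,
        Matrix.cons_val, coordDet]
    · linear_combination
        ((partialD 0 X u 1 * partialD 1 X u 2 - partialD 0 X u 2 * partialD 1 X u 1)
          * partialD 0 X u 0
        + (partialD 0 X u 2 * partialD 1 X u 0 - partialD 0 X u 0 * partialD 1 X u 2)
          * partialD 0 X u 1) * hEF
    · linear_combination
        ((partialD 0 X u 1 * partialD 1 X u 2 - partialD 0 X u 2 * partialD 1 X u 1)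
          * partialD 1 X u 0
        + (partialD 0 X u 2 * partialD 1 X u 0 - partialD 0 X u 0 * partialD 1 X u 2)
          * partialD 1 X u 1) * hEF
    · linear_combination
        ((partialD 0 X u 1 * partialD 1 X u 2 - partialD 0 X u 2 * partialD 1 X u 1)
          * ξ u 0
        + (partialD 0 X u 2 * partialD 1 X u 0 - partialD 0 X u 0 * partialD 1 X u 2)
          * ξ u 1) * hEF
  have n0 := congrArg (fun v : Coord 3 => v 0) hcross
  have n1 := congrArg (fun v : Coord 3 => v 1) hcross
  have n2 := congrArg (fun v : Coord 3 => v 2) hcross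
  simp only [PiLp.sub_apply, PiLp.smul_apply, PiLp.zero_apply, smul_eq_mul,
    Matrix.cons_val_zero, Matrix.cons_val_one, Matrix.cons_val] at n0 n1 n2
  -- If the curvature were minus the identity on bivectors, the expression would be a triple product
  -- with ξ repeated, hence zero. The opposite sign on the horizontal plane leaves twice the third
  -- component, whence the factor 1/2.
  have key : ∀ k, ξ u 2 * (ξ u 0 * partialD k X u 1 - ξ u 1 * partialD k X u 0) = 0 := by
    intro k
    have h := S.covDerivTensor_secondForm_symm_of_divTensor_eq_zero hc hc0 hu hdiv k
    rw [S.codazzi hu, metricInner_curvature_solMetric hX (hX.partialD k)] at h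
    refine (mul_eq_zero.1 ?_).resolve_left hΔ
    linear_combination (1 / 2) * (h + (ξ u 1 * partialD k X u 2 - ξ u 2 * partialD k X u 1) * n0
      + (ξ u 2 * partialD k X u 0 - ξ u 0 * partialD k X u 2) * n1
      - (ξ u 0 * partialD k X u 1 - ξ u 1 * partialD k X u 0) * n2)
  by_cases h2 : ξ u 2 = 0
  · exact Or.inl h2
  right
  have hk := fun k => (mul_eq_zero.1 (key k)).resolve_left h2
  -- This is the horizontal part of ξ turned by a right angle. It is orthogonal to ξ by construction
  -- and to the tangent vectors by `hk`, hence it is zero.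
  have hw : (WithLp.toLp 2 ![Real.exp (-2 * X u 2) * ξ u 1, -(Real.exp (2 * X u 2) * ξ u 0), 0] :
      Coord 3) = 0 := by
    refine eq_zero_of_metricInner_solMetric (x := X u) hΔ ?_ ?_ ?_
    all_goals
      simp only [metricInner_solMetric, Matrix.cons_val_zero, Matrix.cons_val_one,
        Matrix.cons_val]
    · linear_combination (ξ u 1 * partialD 0 X u 0 - ξ u 0 * partialD 0 X u 1) * hEF - hk 0
    · linear_combination (ξ u 1 * partialD 1 X u 0 - ξ u 0 * partialD 1 X u 1) * hEF - hk 1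
    · ring
  have w0 := congrArg (fun v : Coord 3 => v 0) hw
  have w1 := congrArg (fun v : Coord 3 => v 1) hw
  simp [Real.exp_ne_zero] at w0 w1
  exact ⟨w1, w0⟩

/-- The level sets of `z` are minimal. -/
theorem meanCurvature_eq_zero_of_vertical (S : IsLocalSurface U X ξ) (hu : u ∈ U)
    (h0 : ∀ y ∈ U, ξ y 0 = 0) (h1 : ∀ y ∈ U, ξ y 1 = 0) :
    meanCurvature solMetric X ξ u = 0 := by
  have hd := S.det_ne_zero hu
  have ht := S.trace_secondForm hu
  have hξ := (S.normal_smooth u hu).differentiableAt_of_infty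
  have d0 : ∀ i, partialD i ξ u 0 = 0 := fun i => by
    rw [← partialD_coord hξ, partialD_congr (F' := fun _ => 0), partialD_const]
    filter_upwards [S.eventually_mem hu] with y hy using h0 y hy
  have d1 : ∀ i, partialD i ξ u 1 = 0 := fun i => by
    rw [← partialD_coord hξ, partialD_congr (F' := fun _ => 0), partialD_const]
    filter_upwards [S.eventually_mem hu] with y hy using h1 y hy
  have hunit := S.unit u hu
  have hz : ∀ i, partialD i X u 2 = 0 := fun i => by
    have h := S.orthogonal u hu i
    rw [metricInner_solMetric, h0 u hu, h1 u hu] at h hunit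
    have h2 : ξ u 2 ≠ 0 := by rintro h2; simp [h2] at hunit
    simpa [h2] using h
  rw [Matrix.det_fin_two, inducedMetric_comm X u 1 0] at hd
  -- Here h = -ξ₂(e^{2z}dx² - e^{-2z}dy²) while g = e^{2z}dx² + e^{-2z}dy², so the trace vanishes:
  -- the principal curvatures are opposite.
  have key : 2 * meanCurvature solMetric X ξ u
      * (inducedMetric solMetric X u 0 0 * inducedMetric solMetric X u 1 1
        - inducedMetric solMetric X u 0 1 * inducedMetric solMetric X u 0 1) = 0 := by
    rw [← ht]
    simp only [secondForm, inducedMetric_apply, metricInner_solMetric, covDeriv_solMetric_zero,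
      covDeriv_solMetric_one, h0 u hu, h1 u hu, d0, d1, hz]
    ring
  have := (mul_eq_zero.1 key).resolve_right hd
  linarith

theorem mono (S : IsLocalSurface U X ξ) {U' : Set (Coord 2)} (hU' : IsOpen U') (h : U' ⊆ U) :
    IsLocalSurface U' X ξ where
  isOpen := hU'
  smooth u hu := S.smooth u (h hu)
  normal_smooth u hu := S.normal_smooth u (h hu)
  immersion u hu := S.immersion u (h hu)
  unit u hu := S.unit u (h hu)
  orthogonal u hu := S.orthogonal u (h hu)

end IsLocalSurface

/-! ### Surfaces with horizontal normal -/

/-- The coefficient `cos θ` of a horizontal unit normal `cos θ E₁ + sin θ E₂`. -/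
def normalCos (X ξ : Coord 2 → Coord 3) (u : Coord 2) : ℝ := Real.exp (X u 2) * ξ u 0

/-- The coefficient `sin θ` of a horizontal unit normal `cos θ E₁ + sin θ E₂`. -/
def normalSin (X ξ : Coord 2 → Coord 3) (u : Coord 2) : ℝ := Real.exp (-X u 2) * ξ u 1

/-- The 1-form dual to the unit tangent `-sin θ E₁ + cos θ E₂`. -/
def horizontalForm (X ξ : Coord 2 → Coord 3) (i : Fin 2) (u : Coord 2) : ℝ :=
  ξ u 0 * partialD i X u 1 - ξ u 1 * partialD i X u 0

namespace IsLocalSurface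

variable {U : Set (Coord 2)} {X ξ : Coord 2 → Coord 3} {u : Coord 2}

theorem normalCos_sq_add_normalSin_sq (S : IsLocalSurface U X ξ) (hu : u ∈ U)
    (h2 : ξ u 2 = 0) : normalCos X ξ u ^ 2 + normalSin X ξ u ^ 2 = 1 := by
  have h := S.unit u hu
  have hE : Real.exp (2 * X u 2) = Real.exp (X u 2) * Real.exp (X u 2) := by
    rw [← Real.exp_add]; ring_nf
  have hF : Real.exp (-2 * X u 2) = Real.exp (-X u 2) * Real.exp (-X u 2) := by
    rw [← Real.exp_add]; ring_nf
  rw [metricInner_solMetric, h2, hE, hF] at h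
  unfold normalCos normalSin
  linear_combination h

/-- The horizontal part of ∂ᵢX is orthogonal to the horizontal unit vector ξ, hence a multiple of
-sin θ E₁ + cos θ E₂, with coefficient `horizontalForm`. This is its E₁-component; the next lemma
gives the E₂-component. -/
theorem exp_mul_partialD_zero (S : IsLocalSurface U X ξ) (hu : u ∈ U) (h2 : ξ u 2 = 0)
    (i : Fin 2) :
    Real.exp (X u 2) * partialD i X u 0 = -normalSin X ξ u * horizontalForm X ξ i u := by
  have h := S.unit u hu
  have ho := S.orthogonal u hu i
  have hE : Real.exp (2 * X u 2) = Real.exp (X u 2) * Real.exp (X u 2) := by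
    rw [← Real.exp_add]; ring_nf
  have hF : Real.exp (-2 * X u 2) = Real.exp (-X u 2) * Real.exp (-X u 2) := by
    rw [← Real.exp_add]; ring_nf
  have he : Real.exp (X u 2) * Real.exp (-X u 2) = 1 := by simp [← Real.exp_add]
  rw [metricInner_solMetric, h2, hE, hF] at h ho
  unfold normalSin horizontalForm
  linear_combination (-Real.exp (X u 2) * partialD i X u 0) * h
    + (Real.exp (X u 2) * ξ u 0) * ho
    + (-Real.exp (-X u 2) * ξ u 1 * (ξ u 0 * partialD i X u 1 - ξ u 1 * partialD i X u 0)) * he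

theorem exp_neg_mul_partialD_one (S : IsLocalSurface U X ξ) (hu : u ∈ U) (h2 : ξ u 2 = 0)
    (i : Fin 2) :
    Real.exp (-X u 2) * partialD i X u 1 = normalCos X ξ u * horizontalForm X ξ i u := by
  have h := S.unit u hu
  have ho := S.orthogonal u hu i
  have hE : Real.exp (2 * X u 2) = Real.exp (X u 2) * Real.exp (X u 2) := by
    rw [← Real.exp_add]; ring_nf
  have hF : Real.exp (-2 * X u 2) = Real.exp (-X u 2) * Real.exp (-X u 2) := by
    rw [← Real.exp_add]; ring_nf
  have he : Real.exp (X u 2) * Real.exp (-X u 2) = 1 := by simp [← Real.exp_add]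
  rw [metricInner_solMetric, h2, hE, hF] at h ho
  unfold normalCos horizontalForm
  linear_combination (-Real.exp (-X u 2) * partialD i X u 1) * h
    + (Real.exp (-X u 2) * ξ u 1) * ho
    + (Real.exp (X u 2) * ξ u 0 * (ξ u 0 * partialD i X u 1 - ξ u 1 * partialD i X u 0)) * he

theorem contDiffAt_normalCos (S : IsLocalSurface U X ξ) (hu : u ∈ U) :
    ContDiffAt ℝ ∞ (normalCos X ξ) u :=
  (contDiffAt_coord (S.smooth u hu) 2).exp.mul (contDiffAt_coord (S.normal_smooth u hu) 0)

theorem contDiffAt_normalSin (S : IsLocalSurface U X ξ) (hu : u ∈ U) :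
    ContDiffAt ℝ ∞ (normalSin X ξ) u :=
  (contDiffAt_coord (S.smooth u hu) 2).neg.exp.mul (contDiffAt_coord (S.normal_smooth u hu) 1)

theorem partialD_normalCos (S : IsLocalSurface U X ξ) (hu : u ∈ U) (i : Fin 2) :
    partialD i (normalCos X ξ) u
      = Real.exp (X u 2) * (partialD i ξ u 0 + partialD i X u 2 * ξ u 0) := by
  have hX := (S.smooth u hu).differentiableAt_of_infty
  have hξ := (S.normal_smooth u hu).differentiableAt_of_infty
  have hx := differentiableAt_coord hX 2
  change partialD i (fun y => Real.exp (X y 2) * ξ y 0) u = _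
  rw [partialD_mul hx.exp (differentiableAt_coord hξ 0), partialD_exp hx, partialD_coord hX,
    partialD_coord hξ]
  ring

theorem partialD_normalSin (S : IsLocalSurface U X ξ) (hu : u ∈ U) (i : Fin 2) :
    partialD i (normalSin X ξ) u
      = Real.exp (-X u 2) * (partialD i ξ u 1 - partialD i X u 2 * ξ u 1) := by
  have hX := (S.smooth u hu).differentiableAt_of_infty
  have hξ := (S.normal_smooth u hu).differentiableAt_of_infty
  have hx := differentiableAt_coord hX 2
  change partialD i (fun y => Real.exp (-X y 2) * ξ y 1) u = _
  rw [partialD_mul hx.fun_neg.exp (differentiableAt_coord hξ 1), partialD_exp hx.fun_neg,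
    partialD_neg, partialD_coord hX, partialD_coord hξ]
  ring

theorem inducedMetric_of_horizontal (S : IsLocalSurface U X ξ) (hu : u ∈ U) (h2 : ξ u 2 = 0)
    (i j : Fin 2) :
    inducedMetric solMetric X u i j
      = horizontalForm X ξ i u * horizontalForm X ξ j u + partialD i X u 2 * partialD j X u 2 := by
  have hE : Real.exp (2 * X u 2) = Real.exp (X u 2) * Real.exp (X u 2) := by
    rw [← Real.exp_add]; ring_nf
  have hF : Real.exp (-2 * X u 2) = Real.exp (-X u 2) * Real.exp (-X u 2) := by
    rw [← Real.exp_add]; ring_nf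
  have ai := S.exp_mul_partialD_zero hu h2 i
  have aj := S.exp_mul_partialD_zero hu h2 j
  have bi := S.exp_neg_mul_partialD_one hu h2 i
  have bj := S.exp_neg_mul_partialD_one hu h2 j
  have h1 := S.normalCos_sq_add_normalSin_sq hu h2
  rw [inducedMetric_apply, metricInner_solMetric, hE, hF]
  linear_combination (Real.exp (X u 2) * partialD j X u 0) * ai
    - normalSin X ξ u * horizontalForm X ξ i u * aj
    + (Real.exp (-X u 2) * partialD j X u 1) * bi
    + normalCos X ξ u * horizontalForm X ξ i u * bj
    + horizontalForm X ξ i u * horizontalForm X ξ j u * h1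

theorem horizontalForm_wedge_ne_zero (S : IsLocalSurface U X ξ) (hu : u ∈ U) (h2 : ξ u 2 = 0) :
    horizontalForm X ξ 0 u * partialD 1 X u 2 - horizontalForm X ξ 1 u * partialD 0 X u 2 ≠ 0 := by
  intro h
  apply S.det_ne_zero hu
  simp only [Matrix.det_fin_two, S.inducedMetric_of_horizontal hu h2]
  linear_combination (horizontalForm X ξ 0 u * partialD 1 X u 2
    - horizontalForm X ξ 1 u * partialD 0 X u 2) * h

/-- In coframe terms, h = -(dθ ⊗ ω + sin 2θ ω ⊗ dz): the first term comes from the rotation of ξ in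
the frame E₁, E₂, the second from the E₃-component of ∇ξ. -/
theorem secondForm_of_horizontal (S : IsLocalSurface U X ξ) (hu : u ∈ U)
    (h2 : ∀ y ∈ U, ξ y 2 = 0) (i j : Fin 2) :
    secondForm X ξ i j u
      = -((normalCos X ξ u * partialD i (normalSin X ξ) u
          - normalSin X ξ u * partialD i (normalCos X ξ) u) * horizontalForm X ξ j u
        + 2 * normalCos X ξ u * normalSin X ξ u * horizontalForm X ξ i u * partialD j X u 2) := by
  have hE : Real.exp (2 * X u 2) = Real.exp (X u 2) * Real.exp (X u 2) := by
    rw [← Real.exp_add]; ring_nf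
  have hF : Real.exp (-2 * X u 2) = Real.exp (-X u 2) * Real.exp (-X u 2) := by
    rw [← Real.exp_add]; ring_nf
  have ai := S.exp_mul_partialD_zero hu (h2 u hu) i
  have aj := S.exp_mul_partialD_zero hu (h2 u hu) j
  have bi := S.exp_neg_mul_partialD_one hu (h2 u hu) i
  have bj := S.exp_neg_mul_partialD_one hu (h2 u hu) j
  have hc := S.partialD_normalCos hu i
  have hs := S.partialD_normalSin hu i
  have d2 : partialD i ξ u 2 = 0 := by
    rw [← partialD_coord (S.normal_smooth u hu).differentiableAt_of_infty,
      partialD_congr (F' := fun _ => 0), partialD_const]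
    filter_upwards [S.eventually_mem hu] with y hy using h2 y hy
  have e0 : Real.exp (X u 2) * ξ u 0 = normalCos X ξ u := rfl
  have e1 : Real.exp (-X u 2) * ξ u 1 = normalSin X ξ u := rfl
  simp only [secondForm, metricInner_solMetric, covDeriv_solMetric_zero, covDeriv_solMetric_one,
    covDeriv_solMetric_two, h2 u hu, d2, hE, hF]
  linear_combination (Real.exp (X u 2) * partialD j X u 0) * hc
    + (Real.exp (-X u 2) * partialD j X u 1) * hs
    - partialD i (normalCos X ξ) u * aj - partialD i (normalSin X ξ) u * bj
    + (partialD j X u 2 * Real.exp (X u 2) * partialD i X u 0) * e0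
    - (partialD j X u 2 * Real.exp (-X u 2) * partialD i X u 1) * e1
    + (partialD j X u 2 * normalCos X ξ u) * ai - (partialD j X u 2 * normalSin X ξ u) * bi

/-- The differential of the angle `θ` of a horizontal normal on a CMC surface. -/
theorem partialD_angle (S : IsLocalSurface U X ξ) {c : ℝ}
    (hc : ∀ u ∈ U, meanCurvature solMetric X ξ u = c) (h2 : ∀ y ∈ U, ξ y 2 = 0) (hu : u ∈ U)
    (i : Fin 2) :
    normalCos X ξ u * partialD i (normalSin X ξ) u
          - normalSin X ξ u * partialD i (normalCos X ξ) u
      = 2 * normalCos X ξ u * normalSin X ξ u * partialD i X u 2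
        - 2 * c * horizontalForm X ξ i u := by
  have hW := S.horizontalForm_wedge_ne_zero hu (h2 u hu)
  have ht := S.trace_secondForm hu
  have hs := S.secondForm_comm hu 0 1
  simp only [S.secondForm_of_horizontal hu h2, S.inducedMetric_of_horizontal hu (h2 u hu),
    hc u hu] at ht hs
  -- With dθ treated as an unknown 1-form η, the symmetry and the trace of h are two linear
  -- equations for its two components.
  generalize hη : (fun i => normalCos X ξ u * partialD i (normalSin X ξ) u
          - normalSin X ξ u * partialD i (normalCos X ξ) u) = η
  have hη' : ∀ i, normalCos X ξ u * partialD i (normalSin X ξ) u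
          - normalSin X ξ u * partialD i (normalCos X ξ) u = η i := fun i => by rw [← hη]
  simp only [hη'] at ht hs ⊢
  -- `K` says that η - sin 2θ dz + 2cω has zero wedge product with dz, and `hs` says the same for ω.
  -- As ω and dz are independent, `L` concludes that the form vanishes.
  have K := (mul_eq_zero.1 (show ((η 0 - 2 * normalCos X ξ u * normalSin X ξ u * partialD 0 X u 2)
      * partialD 1 X u 2
      - (η 1 - 2 * normalCos X ξ u * normalSin X ξ u * partialD 1 X u 2) * partialD 0 X u 2
      + 2 * c * (horizontalForm X ξ 0 u * partialD 1 X u 2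
        - horizontalForm X ξ 1 u * partialD 0 X u 2))
      * (horizontalForm X ξ 0 u * partialD 1 X u 2
        - horizontalForm X ξ 1 u * partialD 0 X u 2) = 0 by
    linear_combination -ht - (horizontalForm X ξ 0 u * horizontalForm X ξ 1 u
      + partialD 0 X u 2 * partialD 1 X u 2) * hs)).resolve_right hW
  have L : ∀ i, (η i - 2 * normalCos X ξ u * normalSin X ξ u * partialD i X u 2
      + 2 * c * horizontalForm X ξ i u) * (horizontalForm X ξ 0 u * partialD 1 X u 2
        - horizontalForm X ξ 1 u * partialD 0 X u 2) = 0 := by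
    intro i
    fin_cases i <;> simp only [Fin.zero_eta, Fin.mk_one]
    · linear_combination horizontalForm X ξ 0 u * K + partialD 0 X u 2 * hs
    · linear_combination horizontalForm X ξ 1 u * K + partialD 1 X u 2 * hs
  linear_combination (mul_eq_zero.1 (L i)).resolve_right hW

theorem normalCos_mul_partialD (S : IsLocalSurface U X ξ) (h2 : ∀ y ∈ U, ξ y 2 = 0) (hu : u ∈ U)
    (i : Fin 2) :
    normalCos X ξ u * partialD i (normalCos X ξ) u
      + normalSin X ξ u * partialD i (normalSin X ξ) u = 0 := by
  have hp := (S.contDiffAt_normalCos hu).differentiableAt_of_infty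
  have hq := (S.contDiffAt_normalSin hu).differentiableAt_of_infty
  have h : (fun y => normalCos X ξ y * normalCos X ξ y + normalSin X ξ y * normalSin X ξ y)
      =ᶠ[nhds u] fun _ => 1 := by
    filter_upwards [S.eventually_mem hu] with y hy
    linear_combination S.normalCos_sq_add_normalSin_sq hy (h2 y hy)
  have h' := partialD_congr (i := i) h
  rw [partialD_const, partialD_add (hp.fun_mul hp) (hq.fun_mul hq), partialD_mul hp hp,
    partialD_mul hq hq] at h'
  linarith

/-- The exterior derivative of the form dual to the horizontal unit tangent. -/
theorem partialD_horizontalForm_sub (S : IsLocalSurface U X ξ) (h2 : ∀ y ∈ U, ξ y 2 = 0)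
    (hu : u ∈ U) :
    partialD 0 (horizontalForm X ξ 1) u - partialD 1 (horizontalForm X ξ 0) u
      = (normalCos X ξ u ^ 2 - normalSin X ξ u ^ 2)
        * (horizontalForm X ξ 0 u * partialD 1 X u 2
          - horizontalForm X ξ 1 u * partialD 0 X u 2) := by
  have hX := S.smooth u hu
  have hξ := (S.normal_smooth u hu).differentiableAt_of_infty
  have hd : ∀ i j, partialD i (horizontalForm X ξ j) u
      = (partialD i ξ u 0 * partialD j X u 1 + ξ u 0 * partialD i (partialD j X) u 1)
        - (partialD i ξ u 1 * partialD j X u 0 + ξ u 1 * partialD i (partialD j X) u 0) := by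
    intro i j
    have hx := (hX.partialD j).differentiableAt_of_infty
    change partialD i (fun y => ξ y 0 * partialD j X y 1 - ξ y 1 * partialD j X y 0) u = _
    rw [partialD_sub ((differentiableAt_coord hξ 0).fun_mul (differentiableAt_coord hx 1))
      ((differentiableAt_coord hξ 1).fun_mul (differentiableAt_coord hx 0)),
      partialD_mul (differentiableAt_coord hξ 0) (differentiableAt_coord hx 1),
      partialD_mul (differentiableAt_coord hξ 1) (differentiableAt_coord hx 0)]
    simp only [partialD_coord hξ, partialD_coord hx]
  have he : Real.exp (X u 2) * Real.exp (-X u 2) = 1 := by simp [← Real.exp_add]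
  have a := S.exp_mul_partialD_zero hu (h2 u hu)
  have b := S.exp_neg_mul_partialD_one hu (h2 u hu)
  have hm := S.normalCos_mul_partialD h2 hu
  have hc := S.partialD_normalCos hu
  have hs := S.partialD_normalSin hu
  have key : ∀ i j, partialD i ξ u 0 * partialD j X u 1 - partialD i ξ u 1 * partialD j X u 0
      = -(normalCos X ξ u ^ 2 - normalSin X ξ u ^ 2)
        * (partialD i X u 2 * horizontalForm X ξ j u) := by
    intro i j
    have e0 : Real.exp (X u 2) * ξ u 0 = normalCos X ξ u := rfl
    have e1 : Real.exp (-X u 2) * ξ u 1 = normalSin X ξ u := rfl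
    have c0 : Real.exp (X u 2) * partialD i ξ u 0
        = partialD i (normalCos X ξ) u - partialD i X u 2 * normalCos X ξ u := by
      rw [hc, ← e0]; ring
    have c1 : Real.exp (-X u 2) * partialD i ξ u 1
        = partialD i (normalSin X ξ) u + partialD i X u 2 * normalSin X ξ u := by
      rw [hs, ← e1]; ring
    have : partialD i ξ u 0 * partialD j X u 1 - partialD i ξ u 1 * partialD j X u 0
      = (Real.exp (X u 2) * partialD i ξ u 0) * (Real.exp (-X u 2) * partialD j X u 1)
        - (Real.exp (-X u 2) * partialD i ξ u 1) * (Real.exp (X u 2) * partialD j X u 0) := by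
      linear_combination -(partialD i ξ u 0 * partialD j X u 1
        - partialD i ξ u 1 * partialD j X u 0) * he
    rw [this, c0, c1, a, b]
    linear_combination horizontalForm X ξ j u * hm i
  rw [hd, hd, partialD_comm hX 0 1]
  linear_combination key 0 1 - key 1 0

/-- This is the integrability condition d(dθ) = 0 for dθ = sin 2θ dz - 2cω: it contributes -4c cos
2θ from dθ ∧ dz and -2c cos 2θ from dω, so cos 2θ = 0. -/
theorem normalCos_sq_eq_normalSin_sq (S : IsLocalSurface U X ξ) {c : ℝ}
    (hc : ∀ u ∈ U, meanCurvature solMetric X ξ u = c) (hc0 : c ≠ 0)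
    (h2 : ∀ y ∈ U, ξ y 2 = 0) (hu : u ∈ U) :
    normalCos X ξ u ^ 2 - normalSin X ξ u ^ 2 = 0 := by
  have hW := S.horizontalForm_wedge_ne_zero hu (h2 u hu)
  have hX := S.smooth u hu
  have hp := S.contDiffAt_normalCos hu
  have hq := S.contDiffAt_normalSin hu
  have hpd := hp.differentiableAt_of_infty
  have hqd := hq.differentiableAt_of_infty
  have hp' := fun j => (hp.partialD j).differentiableAt_of_infty
  have hq' := fun j => (hq.partialD j).differentiableAt_of_infty
  have hx := fun j => differentiableAt_coord (hX.partialD j).differentiableAt_of_infty 2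
  have hω : ∀ j, DifferentiableAt ℝ (horizontalForm X ξ j) u := fun j =>
    ((differentiableAt_coord (S.normal_smooth u hu).differentiableAt_of_infty 0).mul
      (differentiableAt_coord (hX.partialD j).differentiableAt_of_infty 1)).sub
    ((differentiableAt_coord (S.normal_smooth u hu).differentiableAt_of_infty 1).mul
      (differentiableAt_coord (hX.partialD j).differentiableAt_of_infty 0))
  have hdd : ∀ i j,
      (partialD i (normalCos X ξ) u * partialD j (normalSin X ξ) u
        + normalCos X ξ u * partialD i (partialD j (normalSin X ξ)) u)
        - (partialD i (normalSin X ξ) u * partialD j (normalCos X ξ) u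
        + normalSin X ξ u * partialD i (partialD j (normalCos X ξ)) u)
      = 2 * ((partialD i (normalCos X ξ) u * normalSin X ξ u
          + normalCos X ξ u * partialD i (normalSin X ξ) u) * partialD j X u 2
        + normalCos X ξ u * normalSin X ξ u * partialD i (partialD j X) u 2)
        - 2 * c * partialD i (horizontalForm X ξ j) u := by
    intro i j
    have h : (fun y => normalCos X ξ y * partialD j (normalSin X ξ) y
          - normalSin X ξ y * partialD j (normalCos X ξ) y) =ᶠ[nhds u]
        fun y => 2 * (normalCos X ξ y * normalSin X ξ y * partialD j X y 2)
        - 2 * c * horizontalForm X ξ j y := by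
      filter_upwards [S.eventually_mem hu] with y hy
      rw [S.partialD_angle hc h2 hy]
      ring
    have h' := partialD_congr (i := i) h
    rwa [partialD_sub (hpd.fun_mul (hq' j)) (hqd.fun_mul (hp' j)), partialD_mul hpd (hq' j),
      partialD_mul hqd (hp' j),
      partialD_sub (((hpd.fun_mul hqd).fun_mul (hx j)).const_mul 2) ((hω j).const_mul (2 * c)),
      partialD_const_mul _ ((hpd.fun_mul hqd).fun_mul (hx j)), partialD_const_mul _ (hω j),
      partialD_mul (hpd.fun_mul hqd) (hx j), partialD_mul hpd hqd,
      partialD_coord (hX.partialD j).differentiableAt_of_infty] at h'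
  have h1 := S.normalCos_sq_add_normalSin_sq hu (h2 u hu)
  have hm := S.normalCos_mul_partialD h2 hu
  have hη := S.partialD_angle hc h2 hu
  have hdω := S.partialD_horizontalForm_sub h2 hu
  have h01 := hdd 0 1
  have h10 := hdd 1 0
  rw [partialD_comm hp 1 0, partialD_comm hq 1 0, partialD_comm hX 1 0] at h10
  have hcos : ∀ i, partialD i (normalCos X ξ) u = -normalSin X ξ u *
      (2 * normalCos X ξ u * normalSin X ξ u * partialD i X u 2
        - 2 * c * horizontalForm X ξ i u) := fun i => by
    rw [← hη i]
    linear_combination normalCos X ξ u * hm i - partialD i (normalCos X ξ) u * h1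
  have hsin : ∀ i, partialD i (normalSin X ξ) u = normalCos X ξ u *
      (2 * normalCos X ξ u * normalSin X ξ u * partialD i X u 2
        - 2 * c * horizontalForm X ξ i u) := fun i => by
    rw [← hη i]
    linear_combination normalSin X ξ u * hm i - partialD i (normalSin X ξ) u * h1
  have key : (c * (horizontalForm X ξ 0 u * partialD 1 X u 2
      -- The left side of the antisymmetrized identity is 2 dp ∧ dq, which vanishes because dp = -q
      -- dθ and dq = p dθ are proportional. The total coefficient -6c explains the factor 1/6.
      - horizontalForm X ξ 1 u * partialD 0 X u 2))
      * (normalCos X ξ u ^ 2 - normalSin X ξ u ^ 2) = 0 := by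
    have h := congrArg₂ (· - ·) h01 h10
    simp only [hcos, hsin] at h
    linear_combination (1 / 6) * h - (1 / 3) * c * hdω
  exact (mul_eq_zero.1 key).resolve_left (mul_ne_zero hc0 hW)

/-- A CMC surface with horizontal normal is minimal. -/
theorem eq_zero_of_horizontal (S : IsLocalSurface U X ξ) {c : ℝ}
    (hc : ∀ u ∈ U, meanCurvature solMetric X ξ u = c) (h2 : ∀ y ∈ U, ξ y 2 = 0) (hu : u ∈ U) :
    c = 0 := by
  by_contra hc0
  have hW := S.horizontalForm_wedge_ne_zero hu (h2 u hu)
  have hp := (S.contDiffAt_normalCos hu).differentiableAt_of_infty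
  have hq := (S.contDiffAt_normalSin hu).differentiableAt_of_infty
  have h1 := S.normalCos_sq_add_normalSin_sq hu (h2 u hu)
  have h0 := S.normalCos_sq_eq_normalSin_sq hc hc0 h2 hu
  have hη := S.partialD_angle hc h2 hu
  have hm := S.normalCos_mul_partialD h2 hu
  have hd : ∀ i, normalCos X ξ u * partialD i (normalCos X ξ) u
      - normalSin X ξ u * partialD i (normalSin X ξ) u = 0 := by
    intro i
    have h : (fun y => normalCos X ξ y * normalCos X ξ y - normalSin X ξ y * normalSin X ξ y)
        =ᶠ[nhds u] fun _ => 0 := by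
      filter_upwards [S.eventually_mem hu] with y hy
      linear_combination S.normalCos_sq_eq_normalSin_sq hc hc0 h2 hy
    have h' := partialD_congr (i := i) h
    rw [partialD_const, partialD_sub (hp.fun_mul hp) (hq.fun_mul hq), partialD_mul hp hp,
      partialD_mul hq hq] at h'
    linarith
  -- Since p² + q² = 1 and p² = q² hold near u, both p and q are nonzero with zero differential. So
  -- dθ = 0, and the formula for dθ makes dz and ω linearly dependent.
  have hz : ∀ i, normalCos X ξ u * normalSin X ξ u * partialD i X u 2
      = c * horizontalForm X ξ i u := by
    intro i
    have hc1 : normalCos X ξ u * partialD i (normalCos X ξ) u = 0 := by linarith [hd i, hm i]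
    have hs1 : normalSin X ξ u * partialD i (normalSin X ξ) u = 0 := by linarith [hd i, hm i]
    have hp0 : normalCos X ξ u ≠ 0 := by rintro h; nlinarith
    have hq0 : normalSin X ξ u ≠ 0 := by rintro h; nlinarith
    have h := hη i
    rw [(mul_eq_zero.1 hc1).resolve_left hp0, (mul_eq_zero.1 hs1).resolve_left hq0] at h
    linarith
  apply mul_ne_zero hc0 hW
  linear_combination -partialD 1 X u 2 * hz 0 + partialD 0 X u 2 * hz 1

/-- Biconservative CMC surfaces in Sol are minimal, for parametrized surfaces. -/
theorem eq_zero_of_biconservative (S : IsLocalSurface U X ξ) {c : ℝ}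
    (hc : ∀ u ∈ U, meanCurvature solMetric X ξ u = c)
    (hdiv : ∀ u ∈ U, ∀ k,
      divTensor (inducedMetric solMetric X) (stressBienergy solMetric X) k u = 0) (hu : u ∈ U) :
    c = 0 := by
  by_contra hc0
  have hcase : ∀ y ∈ U, ξ y 2 = 0 ∨ (ξ y 0 = 0 ∧ ξ y 1 = 0) := fun y hy =>
    S.normal_vertical_or_horizontal hc hc0 hy (hdiv y hy)
  have hcont := fun a => (contDiffAt_coord (S.normal_smooth u hu) a).continuousAt
  -- The dichotomy is pointwise, whereas both final cases differentiate the vanishing components of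
  -- ξ. An open condition that excludes one alternative at u makes the other hold on a whole
  -- neighbourhood.
  have restrict : ∀ P : Coord 2 → Prop, (∀ᶠ y in nhds u, P y) →
      ∃ U' ⊆ U, IsOpen U' ∧ u ∈ U' ∧ ∀ y ∈ U', P y := by
    intro P hP
    obtain ⟨U', hU', ho, hmem⟩ := mem_nhds_iff.1 (hP.and (S.eventually_mem hu))
    exact ⟨U', fun y hy => (hU' hy).2, ho, hmem, fun y hy => (hU' hy).1⟩
  by_cases h2 : ξ u 2 = 0
  · have hne : ξ u 0 ≠ 0 ∨ ξ u 1 ≠ 0 := by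
      by_contra! h
      have := S.unit u hu
      simp [metricInner_solMetric, h.1, h.2, h2] at this
    have hev : ∀ᶠ y in nhds u, ξ y 0 ≠ 0 ∨ ξ y 1 ≠ 0 := by
      rcases hne with h | h
      · exact ((hcont 0).eventually_ne h).mono fun y hy => Or.inl hy
      · exact ((hcont 1).eventually_ne h).mono fun y hy => Or.inr hy
    obtain ⟨U', hU', ho, hmem, hP⟩ := restrict _ hev
    refine hc0 ((S.mono ho hU').eq_zero_of_horizontal (fun y hy => hc y (hU' hy))
      (fun y hy => (hcase y (hU' hy)).resolve_right fun h => ?_) hmem)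
    rcases hP y hy with h' | h'
    · exact h' h.1
    · exact h' h.2
  · obtain ⟨U', hU', ho, hmem, hP⟩ := restrict _ ((hcont 2).eventually_ne h2)
    have hv : ∀ y ∈ U', ξ y 0 = 0 ∧ ξ y 1 = 0 := fun y hy =>
      (hcase y (hU' hy)).resolve_left (hP y hy)
    rw [← hc u hu, (S.mono ho hU').meanCurvature_eq_zero_of_vertical hmem (fun y hy => (hv y hy).1)
      (fun y hy => (hv y hy).2)] at hc0
    exact hc0 rfl

end IsLocalSurface

/-! ### Charts -/

/-- By the chain rule: the differential of an inverse chart is injective, so immersivity and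
orthogonality pass from the manifold to the coordinate expression. -/
theorem IsOrientedSurface.isLocalSurface {M : Type*} [TopologicalSpace M]
    [ChartedSpace (EuclideanSpace ℝ (Fin 2)) M] [IsManifold (𝓡 2) ∞ M] {φ ξ : M → Coord 3}
    (h : IsOrientedSurface φ ξ) {e : OpenPartialHomeomorph M (EuclideanSpace ℝ (Fin 2))}
    (he : e ∈ atlas (EuclideanSpace ℝ (Fin 2)) M) :
    IsLocalSurface e.target (φ ∘ e.symm) (ξ ∘ e.symm) := by
  have hmax := IsManifold.subset_maximalAtlas (I := 𝓡 2) (n := ∞) he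
  have hsymm := contMDiffOn_symm_of_mem_maximalAtlas hmax
  have hsm : ∀ ψ : M → Coord 3, ContMDiff (𝓡 2) (𝓡 3) ∞ ψ → ∀ u ∈ e.target,
      ContDiffAt ℝ ∞ (ψ ∘ e.symm) u := by
    intro ψ hψ u hu
    exact ((hψ.comp_contMDiffOn hsymm).contMDiffAt (e.open_target.mem_nhds hu)).contDiffAt
  have hdiff : ∀ u ∈ e.target, ∀ v, fderiv ℝ (φ ∘ e.symm) u v
      = mfderiv (𝓡 2) (𝓡 3) φ (e.symm u) (mfderiv (𝓡 2) (𝓡 2) e.symm u v) := by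
    intro u hu v
    have h1 : MDifferentiableAt (𝓡 2) (𝓡 2) e.symm u :=
      (hsymm.contMDiffAt (e.open_target.mem_nhds hu)).mdifferentiableAt (by simp)
    have h2 : MDifferentiableAt (𝓡 2) (𝓡 3) φ (e.symm u) :=
      h.smooth.contMDiffAt.mdifferentiableAt (by simp)
    rw [← mfderiv_eq_fderiv, mfderiv_comp u h2 h1]
    rfl
  refine ⟨e.open_target, hsm φ h.smooth, hsm ξ h.normal_smooth, ?_, ?_, ?_⟩
  · intro u hu a b hab
    have hinj : Function.Injective (mfderiv (𝓡 2) (𝓡 2) e.symm u) :=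
      (mdifferentiable_of_mem_atlas (I := 𝓡 2) he).symm.mfderiv_injective hu
    have h0 : fderiv ℝ (φ ∘ e.symm) u
        (a • EuclideanSpace.single 0 1 + b • EuclideanSpace.single 1 1) = 0 := by
      rw [map_add, map_smul, map_smul]
      exact hab
    rw [hdiff u hu] at h0
    have h1 := hinj ((h.immersion (e.symm u) (h0.trans (map_zero _).symm)).trans
      (map_zero _).symm)
    have h2 := congrArg (fun v : Coord 2 => v 0) h1
    have h3 := congrArg (fun v : Coord 2 => v 1) h1
    simp at h2 h3
    exact ⟨h2, h3⟩
  · intro u hu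
    exact h.normal_unit (e.symm u)
  · intro u hu i
    unfold partialD
    rw [hdiff u hu]
    exact h.normal_orthogonal (e.symm u) _

end

theorem mainTheorem1 {M : Type*} [TopologicalSpace M]
    [ChartedSpace (EuclideanSpace ℝ (Fin 2)) M] [IsManifold (𝓡 2) ∞ M]
    (φ ξ : M → Coord 3) (hsurf : IsOrientedSurface φ ξ)
    (hcmc : IsCMC φ ξ) (hbicons : IsBiconservative φ) :
    IsMinimal φ ξ := by
  obtain ⟨c, hc⟩ := hcmc
  intro e he u hu
  rw [hc e he u hu, (hsurf.isLocalSurface he).eq_zero_of_biconservative (hc e he)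
    (hbicons e he) hu, zero_smul]
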